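/- **Setting.** Let $\Gamma$ be a countable group. A *standard action* $\alpha\colon\Gamma\curvearrowright(X,\mu)$ is an essentially free, probability measure preserving action on a standard Borel probability space. Let $Z$ be $\mathbb Z$ (with the usual absolute value) or a finite field. Let $L^\infty(\alpha,Z)$ be the ring of essentially bounded measurable functions $X\to Z$ up to equality $\mu$-almost everywhere, with the $\Gamma$-action $(\gamma\cdot f)(x)=f(\gamma^{-1}x)$, and let $R=L^\infty(\alpha,Z)*\Gamma$ be the crossed product ring, with multiplication $(\lambda,\gamma)(\lambda',\gamma')=(\lambda\cdot(\gamma\cdot\lambda'),\gamma\gamma')$. It contains $Z\Gamma$ and acts on $L^\infty(\alpha,Z)$ by $(\lambda,\gamma)\cdot f=\lambda\cdot(\gamma\cdot f)$. *Marked projective modules.* A marked projective $R$-module is $M=\bigoplus_{i\in I}R\chi_{A_i}$ for a finite family $(A_i)_{i\in I}$ of measurable subsets of $X$; its dimension is $\dim M=\sum_{i\in I}\mu(A_i)$. A marked summand of $M$ is $\bigoplus_i R\chi_{B_i}$ with measurable $B_i\subset A_i$. A finite marked decomposition $(M_k)_k$ of $M$ is given by finite measurable partitions $A_i=\bigsqcup_kB_{k,i}$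 and $M_k=\bigoplus_iR\chi_{B_{k,i}}$. *Logarithmic norm* ($Z=\mathbb Z$). Marked projective modules carry the $\ell^1$-norm given on $R$ by $|\sum_\gamma\lambda_\gamma\gamma|_1=\sum_\gamma\int_X|\lambda_\gamma|\,d\mu$ and summed over the components. For an $R$-homomorphism $f\colon M\to N$ of marked projective $R$-modules let $\|f\|$ be the operator norm, let $\operatorname{rk}(f)$ be the infimum of $\dim N'$ over all marked summands $N'\subset N$ with $f(M)\subset N'$, and, with $\log_+=\max(\log,0)$ and $\log_+0=0$, let $$\operatorname{lognorm}'(f)=\min\{\dim(M)\log_+\|f\|,\ \operatorname{rk}(f)\log_+\|f\|\},\qquad \operatorname{lognorm}(f)=\inf_{(M_k)_k}\sum_k\operatorname{lognorm}'(f|_{M_k}),$$ the infimum being over all finite marked decompositions of $M$. *Measured embeddings.* Let $n\in\mathbb N$ and let $\Gamma$ be of type $\mathrm{FP}_{n+1}$, i.e. the trivial $\mathbb Z\Gamma$-module $\mathbb Z$ has a projective resolution that is finitely generated in degrees $\le n+1$. Fix a free $Z\Gamma$-resolution $C_*\twoheadrightarrow Z$ of the trivial module. Let $\mathrm{Aug}_n(\alpha)$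 be the class of all augmented $R$-chain complexes $D_*\twoheadrightarrow L^\infty(\alpha,Z)$ (with surjective augmentation) of marked projective modules for which there is a $Z\Gamma$-chain map $C_*\to D_*$ up to degree $n+1$ extending the inclusion $Z\hookrightarrow L^\infty(\alpha,Z)$ as constant functions. Put $$\operatorname{medim}^Z_n(\alpha)=\inf_{D_*\in\mathrm{Aug}_n(\alpha)}\dim(D_n),\qquad \operatorname{mevol}_n(\alpha)=\inf_{D_*\in\mathrm{Aug}_n(\alpha)}\operatorname{lognorm}(\partial^D_{n+1})\quad(Z=\mathbb Z).$$ *Weak bounded orbit equivalence.* A measurable $A\subset X$ is $\alpha$-cofinite if $F\cdot A=X$ up to measure zero for some finite $F\subset\Gamma$. Standard actions $\alpha\colon\Gamma\curvearrowright(X,\mu)$ and $\beta\colon\Lambda\curvearrowright(Y,\nu)$ are *weakly bounded orbit equivalent of index $c\in\mathbb R_{>0}$* if there are an $\alpha$-cofinite $A\subset X$, a $\beta$-cofinite $B\subset Y$ and a measurable isomorphism $\varphi\colon A\to B$ such that - $\frac1{\mu(A)}\varphi_*\mu|_A=\frac1{\nu(B)}\nu|_B$ and $c=\mu(A)/\nu(B)$;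 - for every $\gamma\in\Gamma$ there is a finite $F(\gamma)\subset\Lambda$ with $\varphi(\gamma x)\in F(\gamma)\cdot\varphi(x)$ for almost every $x\in A\cap\gamma^{-1}A$; - for every $\lambda\in\Lambda$ there is a finite $E(\lambda)\subset\Gamma$ with $\varphi^{-1}(\lambda y)\in E(\lambda)\cdot\varphi^{-1}(y)$ for almost every $y\in B\cap\lambda^{-1}B$. **Theorem.** Let $n\in\mathbb N$, let $\Gamma$ and $\Lambda$ be countable groups of type $\mathrm{FP}_{n+1}$, and let $\alpha$ and $\beta$ be standard actions of $\Gamma$ and $\Lambda$, respectively, that are weakly bounded orbit equivalent of index $c$. Then, for all choices of the free resolutions used in the definitions, $$\operatorname{medim}^Z_n(\alpha)=c\cdot\operatorname{medim}^Z_n(\beta)\quad\text{if $Z$ is $\mathbb Z$ or a finite field},\qquad \operatorname{mevol}_n(\alpha)=c\cdot\operatorname{mevol}_n(\beta).$$ -/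

import Mathlib

open MeasureTheory
open scoped ENNReal Pointwise

noncomputable section

namespace MeasuredEmbedding

/-! ### Essentially bounded functions with values in `Z` -/

section LInfty

variable {X : Type*} [MeasurableSpace X]

/-- The ideal of those simple functions `X → Z` that vanish `μ`-almost everywhere. -/
def nullIdeal (Z : Type*) [CommRing Z] (μ : Measure X) : Ideal (SimpleFunc X Z) where
  carrier := {f | ∀ᵐ x ∂μ, f x = 0}
  zero_mem' := by simp
  add_mem' := by
    intro f g hf hg
    simp only [Set.mem_ofPred_eq] at hf hg ⊢
    filter_upwards [hf, hg] with x h1 h2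
    simp [h1, h2]
  smul_mem' := by
    intro c f hf
    simp only [Set.mem_ofPred_eq] at hf ⊢
    filter_upwards [hf] with x h1
    simp [h1]

/-- `L^∞(X, μ; Z)`: functions that are finite `Z`-linear combinations of characteristic functions
of measurable sets (that is, simple functions), up to equality `μ`-almost everywhere. For
`Z = ℤ` with the usual norm, and for a finite field `Z`, these are precisely the essentially
bounded measurable functions `X → Z` up to equality almost everywhere. -/
def LInfty (Z : Type*) [CommRing Z] (μ : Measure X) : Type _ :=
  SimpleFunc X Z ⧸ nullIdeal Z μ

instance (Z : Type*) [CommRing Z] (μ : Measure X) : CommRing (LInfty Z μ) :=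
  inferInstanceAs (CommRing (SimpleFunc X Z ⧸ nullIdeal Z μ))

/-- The class of a simple function. -/
def LInfty.mk (Z : Type*) [CommRing Z] (μ : Measure X) : SimpleFunc X Z →+* LInfty Z μ :=
  Ideal.Quotient.mk (nullIdeal Z μ)

theorem LInfty.mk_surjective (Z : Type*) [CommRing Z] (μ : Measure X) :
    Function.Surjective (LInfty.mk Z μ) :=
  Ideal.Quotient.mk_surjective

theorem LInfty.mk_eq_mk (Z : Type*) [CommRing Z] (μ : Measure X) (f g : SimpleFunc X Z) :
    LInfty.mk Z μ f = LInfty.mk Z μ g ↔ f =ᵐ[μ] g := by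
  refine (Ideal.Quotient.eq (I := nullIdeal Z μ) (x := f) (y := g)).trans ?_
  change (∀ᵐ x ∂μ, (f - g) x = 0) ↔ _
  simp only [SimpleFunc.coe_sub, Pi.sub_apply, sub_eq_zero]
  rfl

/-- The inclusion of `Z` as the constant functions. -/
def LInfty.const (Z : Type*) [CommRing Z] (μ : Measure X) : Z →+* LInfty Z μ :=
  (LInfty.mk Z μ).comp
    { toFun := SimpleFunc.const X
      map_one' := rfl
      map_zero' := rfl
      map_add' := fun _ _ => rfl
      map_mul' := fun _ _ => rfl }

/-- The characteristic function of a measurable set. -/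
def LInfty.chi (Z : Type*) [CommRing Z] (μ : Measure X) (A : {A : Set X // MeasurableSet A}) :
    LInfty Z μ :=
  LInfty.mk Z μ (SimpleFunc.piecewise A.1 A.2 (SimpleFunc.const X 1) (SimpleFunc.const X 0))

theorem LInfty.chi_mul_chi (Z : Type*) [CommRing Z] (μ : Measure X)
    {A B : {A : Set X // MeasurableSet A}} (h : A ≤ B) :
    LInfty.chi Z μ A * LInfty.chi Z μ B = LInfty.chi Z μ A := by
  unfold LInfty.chi
  rw [← map_mul]
  congr 1
  ext x
  by_cases hx : x ∈ A.1
  · have hB : x ∈ B.1 := h hx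
    simp [hx, hB]
  · simp [hx]

/-- The `L¹`-norm `∫ |a| dμ` of an integer valued function. -/
def LInfty.l1 (μ : Measure X) (a : LInfty ℤ μ) : ℝ :=
  Quotient.liftOn' a (fun f : SimpleFunc X ℤ => ∫ x, |(f x : ℝ)| ∂μ) (by
    intro f g h
    have h' : f =ᵐ[μ] g := (LInfty.mk_eq_mk ℤ μ f g).1 (Quotient.sound' h)
    apply integral_congr_ae
    filter_upwards [h'] with x hx
    rw [hx])

theorem LInfty.l1_mk (μ : Measure X) (f : SimpleFunc X ℤ) :
    LInfty.l1 μ (LInfty.mk ℤ μ f) = ∫ x, |(f x : ℝ)| ∂μ := rfl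

end LInfty

/-! ### The crossed product ring -/

section Rings

variable {X : Type*} [MeasurableSpace X] (Γ : Type*) [Group Γ] [MulAction Γ X]
  [MeasurableConstSMul Γ X] (Z : Type*) [CommRing Z] (μ : Measure X) [SMulInvariantMeasure Γ X μ]

variable {Γ} in
/-- Translation of simple functions: `f ↦ (x ↦ f (γ⁻¹ • x))`. -/
def translate (γ : Γ) : SimpleFunc X Z →+* SimpleFunc X Z where
  toFun f := f.comp (fun x => γ⁻¹ • x) (measurable_const_smul γ⁻¹)
  map_one' := rfl
  map_zero' := rfl
  map_add' := fun _ _ => rfl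
  map_mul' := fun _ _ => rfl

theorem translate_mem (γ : Γ) :
    nullIdeal Z μ ≤ (nullIdeal Z μ).comap (translate Z γ) := by
  intro f hf
  exact (measurePreserving_smul γ⁻¹ μ).quasiMeasurePreserving.ae hf

/-- The action of `Γ` on `L^∞(X, μ; Z)` by `(γ • f) x = f (γ⁻¹ • x)`. -/
instance : MulSemiringAction Γ (LInfty Z μ) where
  smul γ a := Ideal.quotientMap (nullIdeal Z μ) (translate Z γ) (translate_mem Γ Z μ γ) a
  one_smul a := by
    obtain ⟨f, rfl⟩ := LInfty.mk_surjective Z μ a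
    change LInfty.mk Z μ (translate Z (1 : Γ) f) = _
    congr 1
    ext x
    simp [translate]
  mul_smul γ δ a := by
    obtain ⟨f, rfl⟩ := LInfty.mk_surjective Z μ a
    change LInfty.mk Z μ (translate Z (γ * δ) f) =
      LInfty.mk Z μ (translate Z γ (translate Z δ f))
    congr 1
    ext x
    change f ((γ * δ)⁻¹ • x) = f (δ⁻¹ • γ⁻¹ • x)
    rw [mul_inv_rev, mul_smul]
  smul_zero γ := map_zero _
  smul_add γ := map_add _
  smul_one γ := map_one _
  smul_mul γ := map_mul _

theorem smul_mk (γ : Γ) (f : SimpleFunc X Z) :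
    γ • LInfty.mk Z μ f = LInfty.mk Z μ (translate Z γ f) := rfl

theorem smul_const (γ : Γ) (z : Z) : γ • LInfty.const Z μ z = LInfty.const Z μ z := rfl

/-- The crossed product ring `L^∞(X, μ; Z) * Γ`: finite formal sums `∑ λ_γ · γ` with the
multiplication `(λ, γ) · (λ', γ') = (λ · (γ • λ'), γ γ')`. -/
abbrev Crossed : Type _ := SkewMonoidAlgebra (LInfty Z μ) Γ

/-- The ring homomorphism `L^∞ * Γ → End(L^∞)` that sends `(λ, γ)` to `f ↦ λ · (γ • f)`. -/
def crossedToEnd : Crossed Γ Z μ →+* AddMonoid.End (LInfty Z μ) :=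
  SkewMonoidAlgebra.liftNCRingHom (Module.toAddMonoidEnd (LInfty Z μ) (LInfty Z μ))
    (DistribMulAction.toAddMonoidEnd Γ (LInfty Z μ)) (by
      intro a γ
      ext b
      change (γ • a) * (γ • b) = γ • (a * b)
      rw [smul_mul'])

/-- `L^∞(X, μ; Z)` as a left module over the crossed product ring,
`(λ, γ) • f = λ · (γ • f)`. -/
instance : Module (Crossed Γ Z μ) (LInfty Z μ) :=
  Module.compHom (LInfty Z μ) (crossedToEnd Γ Z μ)

theorem single_smul (γ : Γ) (a b : LInfty Z μ) :
    (SkewMonoidAlgebra.single γ a : Crossed Γ Z μ) • b = a * (γ • b) := by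
  exact DFunLike.congr_fun (SkewMonoidAlgebra.liftNC_single
    (Module.toAddMonoidEnd (LInfty Z μ) (LInfty Z μ) : LInfty Z μ →+ AddMonoid.End (LInfty Z μ))
    (DistribMulAction.toAddMonoidEnd Γ (LInfty Z μ)) γ a) b

/-- The inclusion `Z Γ → L^∞(X, μ; Z) * Γ`, `z · γ ↦ (z, γ)`. -/
def groupRingToCrossed : MonoidAlgebra Z Γ →+* Crossed Γ Z μ :=
  MonoidAlgebra.liftNCRingHom
    { toFun := fun z => SkewMonoidAlgebra.single 1 (LInfty.const Z μ z)
      map_one' := by rw [map_one]; rfl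
      map_zero' := by rw [map_zero, SkewMonoidAlgebra.single_zero]
      map_add' := by intro a b; rw [map_add, SkewMonoidAlgebra.single_add]
      map_mul' := by
        intro a b
        rw [SkewMonoidAlgebra.single_mul_single, one_smul, one_mul, map_mul] }
    (SkewMonoidAlgebra.of (LInfty Z μ) Γ)
    (by
      intro z γ
      change SkewMonoidAlgebra.single 1 (LInfty.const Z μ z) * SkewMonoidAlgebra.single γ 1 =
        SkewMonoidAlgebra.single γ 1 * SkewMonoidAlgebra.single 1 (LInfty.const Z μ z)
      rw [SkewMonoidAlgebra.single_mul_single, SkewMonoidAlgebra.single_mul_single, smul_const]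
      simp)

theorem groupRingToCrossed_single (γ : Γ) (z : Z) :
    groupRingToCrossed Γ Z μ (MonoidAlgebra.single γ z) =
      SkewMonoidAlgebra.single γ (LInfty.const Z μ z) := by
  unfold groupRingToCrossed
  rw [MonoidAlgebra.liftNCRingHom_single]
  change SkewMonoidAlgebra.single 1 (LInfty.const Z μ z) * SkewMonoidAlgebra.single γ 1 = _
  rw [SkewMonoidAlgebra.single_mul_single]
  simp

end Rings

/-! ### Resolutions over the group ring -/

/-- The augmentation `Z Γ → Z`, `z · γ ↦ z`. -/
def augmentation (Z Γ : Type*) [CommRing Z] [Group Γ] : MonoidAlgebra Z Γ →+* Z :=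
  (MonoidAlgebra.lift Z Z Γ (1 : Γ →* Z)).toRingHom

/-- A resolution `⋯ → C₁ → C₀ → Z → 0` of the trivial `Z Γ`-module `Z` by `Z Γ`-modules.
Linearity of the augmentation with respect to the trivial module structure is expressed by
semilinearity along `Z Γ → Z`. -/
structure Resolution (Z : Type*) [CommRing Z] (Γ : Type*) [Group Γ] where
  /-- the modules `C_r` -/
  C : ℕ → Type*
  [addCommGroup : ∀ r, AddCommGroup (C r)]
  [module : ∀ r, Module (MonoidAlgebra Z Γ) (C r)]
  /-- the boundary operators `C_{r+1} → C_r` -/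
  d : ∀ r, C (r + 1) →ₗ[MonoidAlgebra Z Γ] C r
  /-- the augmentation `C₀ → Z` -/
  ζ : C 0 →ₛₗ[augmentation Z Γ] Z
  surjective : Function.Surjective ζ
  exact_zero : Function.Exact (d 0) ζ
  exact_succ : ∀ r, Function.Exact (d (r + 1)) (d r)

attribute [instance] Resolution.addCommGroup Resolution.module

/-- A free `Z Γ`-resolution of the trivial module `Z` (of arbitrary, possibly infinite, ranks). -/
structure FreeResolution (Z : Type*) [CommRing Z] (Γ : Type*) [Group Γ] extends
    Resolution Z Γ where
  free : ∀ r, Module.Free (MonoidAlgebra Z Γ) (C r)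

/-- `Γ` is of type `FP_m`: the trivial `ℤ Γ`-module `ℤ` admits a projective resolution that is
finitely generated in degrees `≤ m`. -/
def TypeFP.{u} (m : ℕ) (Γ : Type u) [Group Γ] : Prop :=
  ∃ P : Resolution.{0, u, u} ℤ Γ, (∀ r, Module.Projective (MonoidAlgebra ℤ Γ) (P.C r)) ∧
    ∀ r ≤ m, Module.Finite (MonoidAlgebra ℤ Γ) (P.C r)

/-! ### Marked projective modules -/

/-- A family of measurable subsets of `X`, indexed by `ι`, ordered by componentwise inclusion.
For finite `ι` it describes the marked projective module `⨁ i, R · χ_{A i}`. -/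
abbrev Marking (X : Type*) [MeasurableSpace X] (ι : Type) : Type _ :=
  ι → {A : Set X // MeasurableSet A}

section Modules

variable {X : Type*} [MeasurableSpace X] (Γ : Type*) [Group Γ] [MulAction Γ X]
  [MeasurableConstSMul Γ X] (Z : Type*) [CommRing Z] (μ : Measure X) [SMulInvariantMeasure Γ X μ]

/-- The marked projective module `⨁ i, R · χ_{A i}` over `R = L^∞(X, μ; Z) * Γ`, realised in its
canonical hull `⨁ i, R`. -/
def marked {ι : Type} (A : Marking X ι) : Submodule (Crossed Γ Z μ) (ι → Crossed Γ Z μ) :=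
  Submodule.pi Set.univ fun i =>
    Submodule.span (Crossed Γ Z μ) {SkewMonoidAlgebra.single 1 (LInfty.chi Z μ (A i))}

variable {Γ Z μ} in
theorem marked_mono {ι : Type} {A B : Marking X ι} (h : A ≤ B) :
    marked Γ Z μ A ≤ marked Γ Z μ B := by
  refine Submodule.pi_mono fun i _ => ?_
  rw [Submodule.span_singleton_le_iff_mem, Submodule.mem_span_singleton]
  refine ⟨SkewMonoidAlgebra.single 1 (LInfty.chi Z μ (A i)), ?_⟩
  rw [smul_eq_mul, SkewMonoidAlgebra.single_mul_single, one_smul, one_mul,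
    LInfty.chi_mul_chi Z μ (h i)]

variable {Γ Z μ} in
/-- Restriction of a homomorphism `M → N` to a marked summand of `M`. -/
def restrict {ι κ : Type} {A A' : Marking X ι} {B : Marking X κ} (h : A' ≤ A)
    (f : marked Γ Z μ A →ₗ[Crossed Γ Z μ] marked Γ Z μ B) :
    marked Γ Z μ A' →ₗ[Crossed Γ Z μ] marked Γ Z μ B :=
  f ∘ₗ Submodule.inclusion (marked_mono h)

/-- The dimension `∑ i, μ (A i)` of the marked projective module `⨁ i, R · χ_{A i}`. -/
def dim {ι : Type} [Fintype ι] (A : Marking X ι) : ℝ := ∑ i, μ.real (A i).1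

end Modules

/-! ### The logarithmic norm of homomorphisms between marked projective modules over `ℤ` -/

section LogNorm

variable {X : Type*} [MeasurableSpace X] {Γ : Type*} [Group Γ] [MulAction Γ X]
  [MeasurableConstSMul Γ X] {μ : Measure X} [SMulInvariantMeasure Γ X μ]

/-- The `ℓ¹`-norm `|∑ λ_γ · γ|₁ = ∑_γ ∫ |λ_γ| dμ` on `L^∞(X, μ; ℤ) * Γ`. For essentially free
actions this is the `L¹`-norm of the corresponding function on the orbit relation. -/
def ringNorm (a : Crossed Γ ℤ μ) : ℝ := a.coeff.sum fun _ c => LInfty.l1 μ c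

/-- The `ℓ¹`-norm on `⨁ i, R`, and hence on marked projective modules. -/
def l1Norm {ι : Type} [Fintype ι] (z : ι → Crossed Γ ℤ μ) : ℝ := ∑ i, ringNorm (z i)

variable {ι κ : Type} [Fintype ι] [Fintype κ] {A : Marking X ι} {B : Marking X κ}

/-- The operator norm with respect to the `ℓ¹`-norms. -/
def opNorm (f : marked Γ ℤ μ A →ₗ[Crossed Γ ℤ μ] marked Γ ℤ μ B) : ℝ :=
  sInf {c : ℝ | 0 ≤ c ∧ ∀ z, l1Norm (f z : κ → Crossed Γ ℤ μ) ≤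
    c * l1Norm (z : ι → Crossed Γ ℤ μ)}

/-- The marked rank of `f : M → N`: the infimum of the dimensions of the marked direct summands
of `N` that contain the image of `f`. -/
def markedRank (f : marked Γ ℤ μ A →ₗ[Crossed Γ ℤ μ] marked Γ ℤ μ B) : ℝ :=
  sInf {t : ℝ | ∃ B' : Marking X κ, B' ≤ B ∧
    (∀ z, (f z : κ → Crossed Γ ℤ μ) ∈ marked Γ ℤ μ B') ∧ t = dim μ B'}

/-- `lognorm' f = min (dim M · log⁺ ‖f‖) (rk f · log⁺ ‖f‖)`. -/
def lognorm' (f : marked Γ ℤ μ A →ₗ[Crossed Γ ℤ μ] marked Γ ℤ μ B) : ℝ :=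
  min (dim μ A * Real.posLog (opNorm f)) (markedRank f * Real.posLog (opNorm f))

/-- A finite marked decomposition `M = ⨁ k, M_k` of the marked projective module
`M = ⨁ i, R · χ_{A i}`: every `A i` is partitioned into measurable sets `part k i`, and
`M_k = ⨁ i, R · χ_{part k i}`. -/
structure MarkedDecomposition {X : Type*} [MeasurableSpace X] {ι : Type} (A : Marking X ι) where
  /-- the number of summands -/
  num : ℕ
  /-- the markings of the summands -/
  part : Fin num → Marking X ι
  disjoint : ∀ i, Pairwise fun k l => Disjoint (part k i).1 (part l i).1
  union : ∀ i, ⋃ k, (part k i).1 = (A i).1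

theorem MarkedDecomposition.le {X : Type*} [MeasurableSpace X] {ι : Type} {A : Marking X ι}
    (P : MarkedDecomposition A) (k : Fin P.num) : P.part k ≤ A := by
  intro i
  change (P.part k i).1 ⊆ (A i).1
  rw [← P.union i]
  exact Set.subset_iUnion (fun k => (P.part k i).1) k

/-- The logarithmic norm: the infimum over all finite marked decompositions `(M_k)` of the domain
of `∑ k, lognorm' (f|_{M_k})`. -/
def lognorm (f : marked Γ ℤ μ A →ₗ[Crossed Γ ℤ μ] marked Γ ℤ μ B) : ℝ :=
  ⨅ P : MarkedDecomposition A, ∑ k, lognorm' (restrict (P.le k) f)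

end LogNorm

/-! ### Measured embeddings -/

section Embeddings

variable {X : Type*} [MeasurableSpace X] {Γ : Type*} [Group Γ] [MulAction Γ X]
  [MeasurableConstSMul Γ X] {Z : Type*} [CommRing Z] (μ : Measure X) [SMulInvariantMeasure Γ X μ]

/-- A marked projective augmented chain complex `⋯ → D₁ → D₀ ↠ L^∞(X, μ; Z)` over the crossed
product ring, where `D_r = ⨁ i, R · χ_{A r i}`. -/
structure MarkedComplex (Γ : Type*) [Group Γ] [MulAction Γ X] [MeasurableConstSMul Γ X]
    (Z : Type*) [CommRing Z] (μ : Measure X) [SMulInvariantMeasure Γ X μ] where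
  /-- the rank of the marked presentation of `D_r` -/
  rank : ℕ → ℕ
  /-- the marking of `D_r` -/
  A : ∀ r, Marking X (Fin (rank r))
  /-- the boundary operators `D_{r+1} → D_r` -/
  d : ∀ r, marked Γ Z μ (A (r + 1)) →ₗ[Crossed Γ Z μ] marked Γ Z μ (A r)
  /-- the augmentation `D₀ → L^∞(X, μ; Z)` -/
  η : marked Γ Z μ (A 0) →ₗ[Crossed Γ Z μ] LInfty Z μ
  d_comp_d : ∀ r z, d r (d (r + 1) z) = 0
  η_comp_d : ∀ z, η (d 0 z) = 0
  surjective : Function.Surjective η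

/-- A `Z Γ`-chain map `C_* → D_*` up to degree `n + 1` that extends the inclusion of `Z` into
`L^∞(X, μ; Z)` as constant functions. `Z Γ`-linearity is expressed by semilinearity along the
inclusion `Z Γ → L^∞(X, μ; Z) * Γ`. Nothing is required of `f r` for `r > n + 1`. -/
structure AlphaEmbedding (n : ℕ) (C : FreeResolution Z Γ) (D : MarkedComplex Γ Z μ) where
  /-- the components of the chain map -/
  f : ∀ r, C.C r →ₛₗ[groupRingToCrossed Γ Z μ] marked Γ Z μ (D.A r)
  augmented : ∀ c, D.η (f 0 c) = LInfty.const Z μ (C.ζ c)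
  comm : ∀ r ≤ n, ∀ c, D.d r (f (r + 1) c) = f r (C.d r c)

/-- The class of all augmented complexes that arise in `α`-embeddings up to degree `n`. -/
def Aug (n : ℕ) (C : FreeResolution Z Γ) : Set (MarkedComplex Γ Z μ) :=
  {D | Nonempty (AlphaEmbedding μ n C D)}

/-- The measured embedding dimension over `Z` in degree `n`. -/
def medim (n : ℕ) (C : FreeResolution Z Γ) : ℝ≥0∞ :=
  ⨅ D ∈ Aug μ n C, ENNReal.ofReal (dim μ (D.A n))

/-- The measured embedding volume in degree `n`. -/
def mevol (n : ℕ) (C : FreeResolution ℤ Γ) : ℝ≥0∞ :=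
  ⨅ D ∈ Aug μ n C, ENNReal.ofReal (lognorm (D.d n))

end Embeddings

/-! ### Weak bounded orbit equivalence -/

section OrbitEquivalence

/-- The action is essentially free: almost every point has trivial stabiliser. -/
def EssentiallyFree (Γ : Type*) [Group Γ] {X : Type*} [MeasurableSpace X] [MulAction Γ X]
    (μ : Measure X) : Prop :=
  ∀ᵐ x ∂μ, ∀ γ : Γ, γ • x = x → γ = 1

/-- `A` is cofinite: it is measurable and finitely many translates of `A` cover `X` up to
measure zero. -/
def Cofinite (Γ : Type*) [Group Γ] {X : Type*} [MeasurableSpace X] [MulAction Γ X]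
    (μ : Measure X) (A : Set X) : Prop :=
  MeasurableSet A ∧ ∃ F : Finset Γ, ∀ᵐ x ∂μ, ∃ γ ∈ F, x ∈ γ • A

/-- The actions of `Γ` on `(X, μ)` and of `Λ` on `(Y, ν)` are weakly bounded orbit equivalent of
index `c`. -/
def WeaklyBoundedOE (Γ Λ : Type*) [Group Γ] [Group Λ] {X Y : Type*} [MeasurableSpace X]
    [MeasurableSpace Y] [MulAction Γ X] [MulAction Λ Y] (μ : Measure X) (ν : Measure Y)
    (c : ℝ) : Prop :=
  ∃ (A : Set X) (B : Set Y) (φ : A ≃ᵐ B), Cofinite Γ μ A ∧ Cofinite Λ ν B ∧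
    (μ A)⁻¹ • (μ.comap ((↑) : A → X)).map φ = (ν B)⁻¹ • ν.comap ((↑) : B → Y) ∧
    c = μ.real A / ν.real B ∧
    (∀ γ : Γ, ∃ F : Finset Λ, ∀ᵐ x ∂μ, ∀ (hx : x ∈ A) (hγx : γ • x ∈ A),
      ∃ l ∈ F, (φ ⟨γ • x, hγx⟩ : Y) = l • (φ ⟨x, hx⟩ : Y)) ∧
    (∀ l : Λ, ∃ E : Finset Γ, ∀ᵐ y ∂ν, ∀ (hy : y ∈ B) (hly : l • y ∈ B),
      ∃ γ ∈ E, (φ.symm ⟨l • y, hly⟩ : X) = γ • (φ.symm ⟨y, hy⟩ : X))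

end OrbitEquivalence

end MeasuredEmbedding

end

universe u₁ u₂ v₁ v₂ w w₁ w₂ w₃ w₄

/-!
# Measured embedding invariants under weak bounded orbit equivalence

Let `φ : A ≃ B` be a weak bounded orbit equivalence of index `c`, and let `e = χ_A`, `e' = χ_B`.
The crossed products are Morita equivalent, compatibly with all the structure that enters the
invariants: the corner rings `e R_α e` and `e' R_β e'` are isomorphic, and both idempotents are
full because `A` and `B` are cofinite.

*The corner isomorphism.* For an essentially free action the crossed product acts faithfully on
bounded functions (`eq_of_smul_eq_smul`). Hence `R_α → R_β` may be defined by sending `r` to the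
unique element that acts as `f ↦ (r · (f ∘ φ)) ∘ φ⁻¹`; boundedness of `φ` gives existence
(`BoundedOE.exists_transport`), and multiplicativity on the corner and all other algebraic
identities follow from uniqueness. The transport multiplies the `ℓ¹`-norm by at most
`c⁻¹`; applying this to `φ⁻¹` too shows that it scales the norm by exactly `c⁻¹` on the corner
(`BoundedOE.ringNorm_ringPush`).

*Marked complexes.* Write `X` almost everywhere as a finite disjoint union of pieces `P k` with
`g_k⁻¹ P k ⊆ A`. A marked module `⨁ R_α χ_{A i}` is transported to
`⨁ R_β χ_{φ(g_k⁻¹ (A i ∩ P k))}`, and homomorphisms are transported along. Dimensions are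
multiplied by `c⁻¹`. Since the operator norm of a homomorphism is detected on elements supported over
a cofinite set, operator norms do not change, and marked decompositions and marked summands of the
target can be transported as well. So the logarithmic norm is multiplied by at most `c⁻¹`
(`BoundedOE.lognorm_le`).

*Chain maps.* It remains to see that the transport `D'` of an embedding target `D` is an embedding
target for any free resolution `E` over `Z Λ` (`BoundedOE.pushComplex_mem_Aug`). The given map
`C → D` extends to an `R_α`-linear map `L^∞(X) ⊗_Z C → D`, whose domain is an exact complex because
`L^∞(X)` is torsion-free over the principal ideal domain `Z`. Coinduction along the Morita
equivalence is exact, and the complex coinduced from `L^∞(X) ⊗_Z C` maps to `D'`. The projective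
complex `E` maps to this exact complex by the comparison theorem.

Therefore `c` times the invariant of `β` is at most the invariant of `α`. The situation is
symmetric, so equality follows.
-/

open MeasureTheory
open scoped ENNReal Pointwise

noncomputable section

set_option linter.unusedSectionVars false

namespace MeasuredEmbedding

open scoped TensorProduct

/-! ### Faithfulness of the action of the crossed product on bounded functions -/

section Faithful

variable {X : Type*} [MeasurableSpace X] {Γ : Type*} [Group Γ] [MulAction Γ X]
  [MeasurableConstSMul Γ X] {Z : Type*} [CommRing Z] {μ : Measure X} [SMulInvariantMeasure Γ X μ]

theorem simpleFunc_sum_apply {κ : Type*} (s : Finset κ) (f : κ → SimpleFunc X Z) (x : X) :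
    (∑ k ∈ s, f k) x = ∑ k ∈ s, f k x := by
  classical
  induction s using Finset.induction_on with
  | empty => simp
  | insert a s ha ih => rw [Finset.sum_insert ha, Finset.sum_insert ha, SimpleFunc.add_apply, ih]

theorem translate_apply (γ : Γ) (f : SimpleFunc X Z) (x : X) :
    translate Z γ f x = f (γ⁻¹ • x) := rfl

theorem single_smul_mk (γ : Γ) (f g : SimpleFunc X Z) :
    (SkewMonoidAlgebra.single γ (LInfty.mk Z μ f) : Crossed Γ Z μ) • LInfty.mk Z μ g =
      LInfty.mk Z μ (f * translate Z γ g) := by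
  rw [single_smul, smul_mk, ← map_mul]

theorem smul_eq_sum (r : Crossed Γ Z μ) (b : LInfty Z μ) :
    r • b = ∑ γ ∈ r.support, r.coeff γ * (γ • b) := by
  conv_lhs => rw [← SkewMonoidAlgebra.sum_single r]
  rw [SkewMonoidAlgebra.sum_def', Finset.sum_smul]
  exact Finset.sum_congr rfl fun γ _ => single_smul Γ Z μ γ _ b

/-- A countable family of measurable sets that separates each point from any finite set of other
points. -/
theorem exists_countable_separating_finset (X : Type*) [MeasurableSpace X]
    [StandardBorelSpace X] :
    ∃ 𝒱 : Set (Set X), 𝒱.Countable ∧ (∀ V ∈ 𝒱, MeasurableSet V) ∧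
      ∀ (x : X) (F : Set X), F.Finite → x ∉ F → ∃ V ∈ 𝒱, x ∈ V ∧ Disjoint V F := by
  let := upgradeStandardBorel X
  refine ⟨TopologicalSpace.countableBasis X, TopologicalSpace.countable_countableBasis X,
    fun V hV => (TopologicalSpace.isOpen_of_mem_countableBasis hV).measurableSet, ?_⟩
  intro x F hF hx
  obtain ⟨V, hV, hxV, hVF⟩ := (TopologicalSpace.isBasis_countableBasis X).exists_subset_of_mem_open
    (show x ∈ Fᶜ from hx) hF.isClosed.isOpen_compl
  exact ⟨V, hV, hxV, Set.disjoint_left.2 fun y hy hyF => hVF hy hyF⟩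

/-- For an essentially free action the crossed product acts faithfully on `L^∞`: testing against
the characteristic functions of a countable separating family isolates each coefficient. -/
theorem eq_zero_of_smul_eq_zero [StandardBorelSpace X] (hfree : EssentiallyFree Γ μ)
    (r : Crossed Γ Z μ) (h : ∀ b : LInfty Z μ, r • b = 0) : r = 0 := by
  classical
  obtain ⟨𝒱, hcount, hmeas, hsep⟩ := exists_countable_separating_finset X
  choose f hf using fun γ => LInfty.mk_surjective Z μ (r.coeff γ)
  have key : ∀ V ∈ 𝒱, ∀ᵐ x ∂μ,
      ∑ γ ∈ r.support, f γ x * (if γ⁻¹ • x ∈ V then (1 : Z) else 0) = 0 := by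
    intro V hV
    have h1 := h (LInfty.mk Z μ (SimpleFunc.piecewise V (hmeas V hV) (SimpleFunc.const X 1)
      (SimpleFunc.const X 0)))
    rw [smul_eq_sum] at h1
    simp only [← hf, smul_mk, ← map_mul] at h1
    rw [← map_sum, ← map_zero (LInfty.mk Z μ), LInfty.mk_eq_mk] at h1
    filter_upwards [h1] with x hx
    have h2 := hx
    rw [simpleFunc_sum_apply] at h2
    refine Eq.trans (Finset.sum_congr rfl fun γ _ => ?_) h2
    rw [SimpleFunc.mul_apply, translate_apply]
    by_cases hγ : γ⁻¹ • x ∈ V <;> simp [hγ]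
  rw [← ae_ball_iff hcount] at key
  refine SkewMonoidAlgebra.ext fun γ₀ => ?_
  by_cases hγ₀ : γ₀ ∈ r.support
  swap
  · simpa using hγ₀
  rw [← hf, SkewMonoidAlgebra.coeff_zero, Finsupp.zero_apply, ← map_zero (LInfty.mk Z μ),
    LInfty.mk_eq_mk]
  filter_upwards [key, hfree] with x hx hfx
  have hne : γ₀⁻¹ • x ∉ ((r.support.erase γ₀).image fun γ => γ⁻¹ • x : Finset X) := by
    simp only [Finset.mem_image, Finset.mem_erase, not_exists, not_and, and_imp]
    intro γ hγ _ heq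
    refine hγ ?_
    have : (γ₀ * γ⁻¹) • x = x := by rw [mul_smul, heq, smul_inv_smul]
    exact (mul_inv_eq_one.1 (hfx _ this)).symm
  obtain ⟨V, hV, hxV, hdis⟩ := hsep (γ₀⁻¹ • x) _ (Finset.finite_toSet _) hne
  have h3 := hx V hV
  rw [Finset.sum_eq_single_of_mem γ₀ hγ₀] at h3
  · simpa [hxV] using h3
  · intro γ hγ hγne
    rw [if_neg, mul_zero]
    intro hmem
    refine Set.disjoint_left.1 hdis hmem ?_
    exact Finset.mem_coe.2 (Finset.mem_image.2 ⟨γ, Finset.mem_erase.2 ⟨hγne, hγ⟩, rfl⟩)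

theorem eq_of_smul_eq_smul [StandardBorelSpace X] (hfree : EssentiallyFree Γ μ)
    {r s : Crossed Γ Z μ} (h : ∀ b : LInfty Z μ, r • b = s • b) : r = s :=
  sub_eq_zero.1 (eq_zero_of_smul_eq_zero hfree _ fun b => by rw [sub_smul, h, sub_self])

end Faithful

/-! ### Idempotents of the crossed product -/

section Chi

variable {X : Type*} [MeasurableSpace X] {Γ : Type*} [Group Γ] [MulAction Γ X]
  [MeasurableConstSMul Γ X] {Z : Type*} [CommRing Z] {μ : Measure X} [SMulInvariantMeasure Γ X μ]

variable (Γ Z μ) in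
/-- The idempotent `χ_S` of the crossed product ring. -/
def chiRing (S : {S : Set X // MeasurableSet S}) : Crossed Γ Z μ :=
  SkewMonoidAlgebra.single 1 (LInfty.chi Z μ S)

theorem chiRing_smul (S : {S : Set X // MeasurableSet S})
    (b : LInfty Z μ) : chiRing Γ Z μ S • b = LInfty.chi Z μ S * b := by
  rw [chiRing, single_smul, one_smul]

theorem chiRing_mul_of_le {S S' : {S : Set X // MeasurableSet S}}
    (h : S ≤ S') : chiRing Γ Z μ S * chiRing Γ Z μ S' = chiRing Γ Z μ S := by
  rw [chiRing, chiRing, SkewMonoidAlgebra.single_mul_single, one_smul, one_mul,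
    LInfty.chi_mul_chi Z μ h]

theorem chiRing_mul_comm (S S' : {S : Set X // MeasurableSet S}) :
    chiRing Γ Z μ S * chiRing Γ Z μ S' = chiRing Γ Z μ S' * chiRing Γ Z μ S := by
  rw [chiRing, chiRing, SkewMonoidAlgebra.single_mul_single, SkewMonoidAlgebra.single_mul_single,
    one_smul, one_smul, mul_comm]

theorem chiRing_mul_of_ge {S S' : {S : Set X // MeasurableSet S}}
    (h : S ≤ S') : chiRing Γ Z μ S' * chiRing Γ Z μ S = chiRing Γ Z μ S := by
  rw [chiRing_mul_comm, chiRing_mul_of_le h]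

end Chi

/-! ### Transport of bounded functions and of crossed products -/

/-- A weak bounded orbit equivalence of index `c` between essentially free actions, in a form that
is symmetric in the two sides: the isomorphism `A ≃ B` is given by total measurable maps
`p : X → Y` and `q : Y → X` that restrict to mutually inverse bijections between `A` and `B`. -/
structure BoundedOE (Γ Λ : Type*) [Group Γ] [Group Λ] {X Y : Type*} [MeasurableSpace X]
    [MeasurableSpace Y] [MulAction Γ X] [MulAction Λ Y] (μ : Measure X) (ν : Measure Y)
    (c : ℝ) where
  /-- the cofinite subset of `X` -/
  A : Set X
  /-- the cofinite subset of `Y` -/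
  B : Set Y
  /-- the isomorphism `A → B`, extended arbitrarily to `X` -/
  p : X → Y
  /-- the inverse isomorphism `B → A`, extended arbitrarily to `Y` -/
  q : Y → X
  free_left : EssentiallyFree Γ μ
  free_right : EssentiallyFree Λ ν
  cofinite_left : Cofinite Γ μ A
  cofinite_right : Cofinite Λ ν B
  measurable_p : Measurable p
  measurable_q : Measurable q
  p_mem : ∀ x ∈ A, p x ∈ B
  q_mem : ∀ y ∈ B, q y ∈ A
  q_p : ∀ x ∈ A, q (p x) = x
  p_q : ∀ y ∈ B, p (q y) = y
  pos : 0 < c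
  map_p : (μ.restrict A).map p = ENNReal.ofReal c • ν.restrict B
  map_q : (ν.restrict B).map q = ENNReal.ofReal c⁻¹ • μ.restrict A
  bounded_p : ∀ γ : Γ, ∃ F : Finset Λ, ∀ᵐ x ∂μ, x ∈ A → γ • x ∈ A →
    ∃ l ∈ F, p (γ • x) = l • p x
  bounded_q : ∀ l : Λ, ∃ E : Finset Γ, ∀ᵐ y ∂ν, y ∈ B → l • y ∈ B →
    ∃ γ ∈ E, q (l • y) = γ • q y

namespace BoundedOE

section Basic

variable {Γ Λ : Type*} [Group Γ] [Group Λ] {X Y : Type*} [MeasurableSpace X]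
    [MeasurableSpace Y] [MulAction Γ X] [MulAction Λ Y] {μ : Measure X} {ν : Measure Y}
    {c : ℝ} (T : BoundedOE Γ Λ μ ν c)

/-- The inverse orbit equivalence. -/
def symm : BoundedOE Λ Γ ν μ c⁻¹ where
  A := T.B
  B := T.A
  p := T.q
  q := T.p
  free_left := T.free_right
  free_right := T.free_left
  cofinite_left := T.cofinite_right
  cofinite_right := T.cofinite_left
  measurable_p := T.measurable_q
  measurable_q := T.measurable_p
  p_mem := T.q_mem
  q_mem := T.p_mem
  q_p := T.p_q
  p_q := T.q_p
  pos := inv_pos.2 T.pos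
  map_p := T.map_q
  map_q := by rw [inv_inv]; exact T.map_p
  bounded_p := T.bounded_q
  bounded_q := T.bounded_p

theorem measurableSet_A : MeasurableSet T.A := T.cofinite_left.1

theorem measurableSet_B : MeasurableSet T.B := T.cofinite_right.1

/-- Null sets are transported to null sets. -/
theorem ae_q {P : X → Prop} (h : ∀ᵐ x ∂μ, P x) : ∀ᵐ y ∂ν, y ∈ T.B → P (T.q y) := by
  rw [← ae_restrict_iff' T.measurableSet_B]
  refine ae_of_ae_map (p := P) T.measurable_q.aemeasurable ?_
  rw [T.map_q]
  exact Measure.ae_smul_measure (ae_restrict_of_ae h) _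

/-- The image `φ (S ∩ A)` of a measurable set under the isomorphism `φ : A ≃ B`. -/
def image (S : {S : Set X // MeasurableSet S}) : {S : Set Y // MeasurableSet S} :=
  ⟨T.B ∩ T.q ⁻¹' S.1, T.measurableSet_B.inter (T.measurable_q S.2)⟩

theorem real_image (S : {S : Set X // MeasurableSet S}) :
    ν.real (T.image S).1 = c⁻¹ * μ.real (T.A ∩ S.1) := by
  have h := congrArg (fun m : Measure X => m S.1) T.map_q
  simp only [Measure.map_apply T.measurable_q S.2, Measure.smul_apply,
    Measure.restrict_apply S.2, Measure.restrict_apply (T.measurable_q S.2), smul_eq_mul] at h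
  change (ν (T.B ∩ T.q ⁻¹' S.1)).toReal = _
  rw [measureReal_def, Set.inter_comm, h, ENNReal.toReal_mul,
    ENNReal.toReal_ofReal (inv_pos.2 T.pos).le, Set.inter_comm]

/-- The set of those `y ∈ B` at which `γ⁻¹`, transported to `Y`, acts as `l`. -/
def piece (γ : Γ) (l : Λ) : Set Y :=
  {y | y ∈ T.B ∧ γ⁻¹ • T.q y ∈ T.A ∧ T.p (γ⁻¹ • T.q y) = l • y}

/-- Almost every `y ∈ B` with `γ⁻¹ • φ⁻¹ y ∈ A` lies in exactly one of finitely many pieces. -/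
theorem exists_finset_piece (γ : Γ) : ∃ F : Finset Λ, ∀ᵐ y ∂ν,
    (y ∈ T.B → γ⁻¹ • T.q y ∈ T.A → ∃ l ∈ F, y ∈ T.piece γ l) ∧
    ∀ l l' : Λ, y ∈ T.piece γ l → y ∈ T.piece γ l' → l = l' := by
  obtain ⟨F, hF⟩ := T.bounded_p γ⁻¹
  refine ⟨F, ?_⟩
  filter_upwards [T.ae_q hF, T.free_right] with y hy hfree
  constructor
  · intro hB hA
    obtain ⟨l, hl, h⟩ := hy hB (T.q_mem y hB) hA
    rw [T.p_q y hB] at h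
    exact ⟨l, hl, hB, hA, h⟩
  · intro l l' hl hl'
    have h : l • y = l' • y := hl.2.2.symm.trans hl'.2.2
    have h' : (l'⁻¹ * l) • y = y := by rw [mul_smul, h, inv_smul_smul]
    exact (inv_mul_eq_one.1 (hfree _ h')).symm

variable {Z : Type*} [CommRing Z]

/-- Transport of simple functions: `f ∘ φ⁻¹` on `B`, extended by `0`. -/
def pushSimple (f : SimpleFunc X Z) : SimpleFunc Y Z :=
  SimpleFunc.piecewise T.B T.measurableSet_B (f.comp T.q T.measurable_q) 0

theorem pushSimple_of_mem (f : SimpleFunc X Z) {y : Y} (hy : y ∈ T.B) :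
    T.pushSimple f y = f (T.q y) := by
  simp [pushSimple, hy]

theorem pushSimple_of_notMem (f : SimpleFunc X Z) {y : Y} (hy : y ∉ T.B) :
    T.pushSimple f y = 0 := by
  simp [pushSimple, hy]

/-- Transport of bounded functions: `f ∘ φ⁻¹` on `B`, extended by `0`. -/
def push : LInfty Z μ →+ LInfty Z ν :=
  AddMonoidHom.mk' (fun a => Quotient.liftOn' a (fun f => LInfty.mk Z ν (T.pushSimple f)) (by
      intro f g h
      have h' : f =ᵐ[μ] g := (LInfty.mk_eq_mk Z μ f g).1 (Quotient.sound' h)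
      rw [LInfty.mk_eq_mk]
      filter_upwards [T.ae_q h'] with y hy
      by_cases hB : y ∈ T.B
      · rw [T.pushSimple_of_mem _ hB, T.pushSimple_of_mem _ hB, hy hB]
      · rw [T.pushSimple_of_notMem _ hB, T.pushSimple_of_notMem _ hB])) (by
    intro a b
    obtain ⟨f, rfl⟩ := LInfty.mk_surjective Z μ a
    obtain ⟨g, rfl⟩ := LInfty.mk_surjective Z μ b
    change LInfty.mk Z ν (T.pushSimple (f + g)) =
      LInfty.mk Z ν (T.pushSimple f) + LInfty.mk Z ν (T.pushSimple g)
    rw [← map_add]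
    congr 1
    ext y
    by_cases hB : y ∈ T.B
    · simp [T.pushSimple_of_mem _ hB]
    · simp [T.pushSimple_of_notMem _ hB])

theorem push_mk (f : SimpleFunc X Z) :
    T.push (LInfty.mk Z μ f) = LInfty.mk Z ν (T.pushSimple f) := rfl

theorem push_mul (a b : LInfty Z μ) : T.push (a * b) = T.push a * T.push b := by
  obtain ⟨f, rfl⟩ := LInfty.mk_surjective Z μ a
  obtain ⟨g, rfl⟩ := LInfty.mk_surjective Z μ b
  rw [← map_mul, push_mk, push_mk, push_mk, ← map_mul]
  congr 1
  ext y
  by_cases hB : y ∈ T.B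
  · simp [T.pushSimple_of_mem _ hB]
  · simp [T.pushSimple_of_notMem _ hB]

theorem push_chi (S : {S : Set X // MeasurableSet S}) :
    T.push (LInfty.chi Z μ S) = LInfty.chi Z ν (T.image S) := by
  unfold LInfty.chi
  rw [push_mk]
  congr 1
  ext y
  by_cases hB : y ∈ T.B
  · rw [T.pushSimple_of_mem _ hB]
    by_cases hS : T.q y ∈ S.1 <;> simp [image, hB, hS]
  · rw [T.pushSimple_of_notMem _ hB]
    simp [image, hB]

/-- The domain `A` as a measurable set. -/
abbrev dom : {S : Set X // MeasurableSet S} := ⟨T.A, T.measurableSet_A⟩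

theorem push_symm_push (a : LInfty Z μ) :
    T.symm.push (T.push a) = LInfty.chi Z μ T.dom * a := by
  obtain ⟨f, rfl⟩ := LInfty.mk_surjective Z μ a
  unfold LInfty.chi
  rw [push_mk, push_mk, ← map_mul]
  congr 1
  ext x
  by_cases hA : x ∈ T.A
  · rw [T.symm.pushSimple_of_mem _ hA]
    change T.pushSimple f (T.p x) = _
    rw [T.pushSimple_of_mem _ (T.p_mem x hA), T.q_p x hA]
    simp [hA]
  · rw [T.symm.pushSimple_of_notMem _ hA]
    simp [hA]

theorem image_dom : T.image T.dom = T.symm.dom := by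
  refine Subtype.ext (Set.inter_eq_left.2 fun y hy => T.q_mem y hy)

theorem push_chi_dom_mul (a : LInfty Z μ) : T.push (LInfty.chi Z μ T.dom * a) = T.push a := by
  rw [push_mul, push_chi, image_dom]
  obtain ⟨f, rfl⟩ := LInfty.mk_surjective Z μ a
  unfold LInfty.chi
  rw [push_mk, ← map_mul]
  congr 1
  ext y
  by_cases hB : y ∈ T.B
  · have : y ∈ T.symm.A := hB
    simp [this]
  · simp [T.pushSimple_of_notMem _ hB]

theorem chi_dom_mul_push (a : LInfty Z μ) :
    LInfty.chi Z ν T.symm.dom * T.push a = T.push a := by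
  rw [← image_dom, ← push_chi, ← push_mul, push_chi_dom_mul]

end Basic

section Piece

variable {Γ Λ : Type*} [Group Γ] [Group Λ] {X Y : Type*} [MeasurableSpace X]
  [MeasurableSpace Y] [StandardBorelSpace Y]
  [MulAction Γ X] [MulAction Λ Y] [MeasurableConstSMul Γ X] [MeasurableConstSMul Λ Y]
  {μ : Measure X} {ν : Measure Y} {c : ℝ} (T : BoundedOE Γ Λ μ ν c) {Z : Type*} [CommRing Z]

theorem measurableSet_piece (γ : Γ) (l : Λ) : MeasurableSet (T.piece γ l) := by
  have h1 : Measurable fun y => γ⁻¹ • T.q y := (measurable_const_smul γ⁻¹).comp T.measurable_q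
  have h2 : MeasurableSet {y | T.p (γ⁻¹ • T.q y) = l • y} :=
    measurableSet_eq_fun (T.measurable_p.comp h1) (measurable_const_smul l)
  exact T.measurableSet_B.inter ((h1 T.measurableSet_A).inter h2)

/-- The transport of `λ · γ` restricted to the piece where it acts as `l⁻¹`. -/
def pieceCoeff (γ : Γ) (l : Λ) (f : SimpleFunc X Z) : SimpleFunc Y Z :=
  SimpleFunc.piecewise (T.piece γ l) (T.measurableSet_piece γ l) (T.pushSimple f) 0

theorem pieceCoeff_of_mem {γ : Γ} {l : Λ} (f : SimpleFunc X Z) {y : Y} (hy : y ∈ T.piece γ l) :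
    T.pieceCoeff γ l f y = f (T.q y) := by
  rw [← T.pushSimple_of_mem f hy.1]
  simp [pieceCoeff, hy]

theorem pieceCoeff_of_notMem {γ : Γ} {l : Λ} (f : SimpleFunc X Z) {y : Y}
    (hy : y ∉ T.piece γ l) : T.pieceCoeff γ l f y = 0 := by
  simp [pieceCoeff, hy]

end Piece

section Ring

variable {Γ Λ : Type*} [Group Γ] [Group Λ] {X Y : Type*} [MeasurableSpace X]
  [MeasurableSpace Y] [StandardBorelSpace Y]
  [MulAction Γ X] [MulAction Λ Y] [MeasurableConstSMul Γ X] [MeasurableConstSMul Λ Y]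
  {μ : Measure X} {ν : Measure Y} [SMulInvariantMeasure Γ X μ] [SMulInvariantMeasure Λ Y ν]
  {c : ℝ} (T : BoundedOE Γ Λ μ ν c) {Z : Type*} [CommRing Z]

/-- The transport of `λ · γ` is the sum over the finitely many pieces on which `γ⁻¹` acts as
an element `l` of the other group. -/
theorem single_transport (γ : Γ) (f : SimpleFunc X Z) (F : Finset Λ) (hF : ∀ᵐ y ∂ν,
    (y ∈ T.B → γ⁻¹ • T.q y ∈ T.A → ∃ l ∈ F, y ∈ T.piece γ l) ∧
    ∀ l l' : Λ, y ∈ T.piece γ l → y ∈ T.piece γ l' → l = l') (b : LInfty Z ν) :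
    (∑ l ∈ F, SkewMonoidAlgebra.single l⁻¹ (LInfty.mk Z ν (T.pieceCoeff γ l f)) :
      Crossed Λ Z ν) • b =
    T.push ((SkewMonoidAlgebra.single γ (LInfty.mk Z μ f) : Crossed Γ Z μ) • T.symm.push b) := by
  obtain ⟨g, rfl⟩ := LInfty.mk_surjective Z ν b
  rw [Finset.sum_smul, push_mk, single_smul_mk, push_mk]
  simp only [single_smul_mk]
  rw [← map_sum, LInfty.mk_eq_mk]
  filter_upwards [hF] with y hy
  rw [simpleFunc_sum_apply]
  have hterm : ∀ l, (T.pieceCoeff γ l f * translate Z l⁻¹ g) y =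
      T.pieceCoeff γ l f y * g (l • y) := by
    intro l
    rw [SimpleFunc.mul_apply, translate_apply, inv_inv]
  simp only [hterm]
  by_cases hB : y ∈ T.B
  · rw [T.pushSimple_of_mem _ hB, SimpleFunc.mul_apply, translate_apply]
    by_cases hA : γ⁻¹ • T.q y ∈ T.A
    · obtain ⟨l, hl, hyl⟩ := hy.1 hB hA
      rw [Finset.sum_eq_single_of_mem l hl, T.pieceCoeff_of_mem f hyl,
        T.symm.pushSimple_of_mem g hA]
      · change _ = _ * g (T.p _)
        rw [hyl.2.2]
      · intro l' _ hne
        rw [T.pieceCoeff_of_notMem f fun h => hne (hy.2 l' l h hyl), zero_mul]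
    · rw [T.symm.pushSimple_of_notMem g hA, mul_zero]
      refine Finset.sum_eq_zero fun l _ => ?_
      rw [T.pieceCoeff_of_notMem f fun h => hA h.2.1, zero_mul]
  · rw [T.pushSimple_of_notMem _ hB]
    refine Finset.sum_eq_zero fun l _ => ?_
    rw [T.pieceCoeff_of_notMem f fun h => hB h.1, zero_mul]

theorem exists_transport (r : Crossed Γ Z μ) :
    ∃ r' : Crossed Λ Z ν, ∀ b : LInfty Z ν, r' • b = T.push (r • T.symm.push b) := by
  induction r using SkewMonoidAlgebra.induction_on with
  | zero => exact ⟨0, fun b => by rw [zero_smul, zero_smul, map_zero]⟩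
  | single γ a =>
    obtain ⟨f, rfl⟩ := LInfty.mk_surjective Z μ a
    obtain ⟨F, hF⟩ := T.exists_finset_piece γ
    exact ⟨_, T.single_transport γ f F hF⟩
  | add r s hr hs =>
    obtain ⟨r', hr'⟩ := hr
    obtain ⟨s', hs'⟩ := hs
    exact ⟨r' + s', fun b => by rw [add_smul, add_smul, map_add, hr', hs']⟩

/-- The transport of crossed products `R_α → R_β`. It sends `r` to the unique element of `R_β` that
acts on `L^∞(Y)` as `f ↦ (r · (f ∘ φ)) ∘ φ⁻¹`, where both compositions are extended by zero.
It factors through `r ↦ χ_A r χ_A` and restricts to an isomorphism of the corner rings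
`χ_A R_α χ_A ≅ χ_B R_β χ_B`. -/
def ringPush : Crossed Γ Z μ →+ Crossed Λ Z ν :=
  AddMonoidHom.mk' (fun r => (T.exists_transport r).choose) (by
    intro r s
    refine eq_of_smul_eq_smul T.free_right fun b => ?_
    rw [(T.exists_transport (r + s)).choose_spec, add_smul, add_smul, map_add,
      (T.exists_transport r).choose_spec, (T.exists_transport s).choose_spec])

theorem ringPush_smul (r : Crossed Γ Z μ) (b : LInfty Z ν) :
    T.ringPush r • b = T.push (r • T.symm.push b) :=
  (T.exists_transport r).choose_spec b

end Ring

section Corner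

variable {Γ Λ : Type*} [Group Γ] [Group Λ] {X Y : Type*} [MeasurableSpace X]
  [MeasurableSpace Y] [StandardBorelSpace Y]
  [MulAction Γ X] [MulAction Λ Y] [MeasurableConstSMul Γ X] [MeasurableConstSMul Λ Y]
  {μ : Measure X} {ν : Measure Y} [SMulInvariantMeasure Γ X μ] [SMulInvariantMeasure Λ Y ν]
  {c : ℝ} (T : BoundedOE Γ Λ μ ν c) {Z : Type*} [CommRing Z]

theorem push_smul_dom (r : Crossed Γ Z μ) (a : LInfty Z μ) :
    T.push ((r * chiRing Γ Z μ T.dom) • a) = T.ringPush r • T.push a := by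
  rw [ringPush_smul, push_symm_push, mul_smul, chiRing_smul]

theorem ringPush_mul_dom (r s : Crossed Γ Z μ) :
    T.ringPush (r * chiRing Γ Z μ T.dom * s) = T.ringPush r * T.ringPush s := by
  refine eq_of_smul_eq_smul T.free_right fun b => ?_
  rw [ringPush_smul, mul_smul (T.ringPush r), ringPush_smul T s, ← push_smul_dom, mul_smul]

theorem ringPush_dom_mul (r : Crossed Γ Z μ) :
    T.ringPush (chiRing Γ Z μ T.dom * r) = T.ringPush r := by
  refine eq_of_smul_eq_smul T.free_right fun b => ?_
  rw [ringPush_smul, ringPush_smul, mul_smul, chiRing_smul, push_chi_dom_mul]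

theorem ringPush_mul_dom_right (r : Crossed Γ Z μ) :
    T.ringPush (r * chiRing Γ Z μ T.dom) = T.ringPush r := by
  refine eq_of_smul_eq_smul T.free_right fun b => ?_
  rw [ringPush_smul, ringPush_smul, mul_smul, chiRing_smul]
  exact congrArg _ (congrArg _ (T.symm.chi_dom_mul_push b))

theorem ringPush_symm_ringPush [StandardBorelSpace X] (r : Crossed Γ Z μ) :
    T.symm.ringPush (T.ringPush r) = chiRing Γ Z μ T.dom * r * chiRing Γ Z μ T.dom := by
  refine eq_of_smul_eq_smul T.free_left fun b => ?_
  rw [ringPush_smul, ringPush_smul, push_symm_push, mul_smul, mul_smul, chiRing_smul,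
    chiRing_smul]
  exact congrArg _ (congrArg _ (T.push_symm_push b))

theorem ringPush_chi (S : {S : Set X // MeasurableSet S}) :
    T.ringPush (chiRing Γ Z μ S) = chiRing Λ Z ν (T.image S) := by
  refine eq_of_smul_eq_smul T.free_right fun b => ?_
  rw [ringPush_smul, chiRing_smul, chiRing_smul, push_mul, push_chi]
  rw [show T.push (T.symm.push b) = _ from T.symm.push_symm_push b, ← mul_assoc,
    LInfty.chi_mul_chi Z ν (show T.image S ≤ T.symm.dom from Set.inter_subset_left)]

theorem ringPush_dom : T.ringPush (chiRing Γ Z μ T.dom) = chiRing Λ Z ν T.symm.dom := by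
  rw [ringPush_chi, image_dom]

theorem ringPush_one : T.ringPush (1 : Crossed Γ Z μ) = chiRing Λ Z ν T.symm.dom := by
  rw [← ringPush_dom, ← ringPush_mul_dom_right, one_mul]

end Corner

end BoundedOE

/-! ### Partitions into translates of subsets of a cofinite set -/

section Partition

/-- A finite almost everywhere partition of `X` into measurable sets `P k`, each of which is
translated into `A` by `(g k)⁻¹`. -/
structure TranslatePartition (Γ : Type*) [Group Γ] {X : Type*} [MeasurableSpace X]
    [MulAction Γ X] (μ : Measure X) (A : Set X) where
  /-- the number of pieces -/
  num : ℕ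
  /-- the translating group elements -/
  g : Fin num → Γ
  /-- the pieces -/
  P : Fin num → {S : Set X // MeasurableSet S}
  disjoint : Pairwise fun k l => Disjoint (P k).1 (P l).1
  cover : ∀ᵐ x ∂μ, ∃ k, x ∈ (P k).1
  mem : ∀ k, ∀ x ∈ (P k).1, (g k)⁻¹ • x ∈ A

variable {Γ : Type*} [Group Γ] {X : Type*} [MeasurableSpace X] [MulAction Γ X]
  [MeasurableConstSMul Γ X] {μ : Measure X}

theorem Cofinite.nonempty_translatePartition {A : Set X} (h : Cofinite Γ μ A) :
    Nonempty (TranslatePartition Γ μ A) := by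
  obtain ⟨hA, F, hF⟩ := h
  let g : Fin F.card → Γ := fun k => (F.equivFin.symm k : Γ)
  let S : Fin F.card → Set X := fun k => g k • A
  have hS : ∀ k, MeasurableSet (S k) := fun k => hA.const_smul (g k)
  refine ⟨⟨F.card, g, fun k => ⟨disjointed S k, ?_⟩, disjoint_disjointed S, ?_, ?_⟩⟩
  · exact disjointedRec (p := fun s => MeasurableSet s) (fun _ i ht => ht.diff (hS i)) (hS k)
  · filter_upwards [hF] with x ⟨γ, hγ, hx⟩
    have h1 : x ∈ ⋃ k, S k := Set.mem_iUnion.2 ⟨F.equivFin ⟨γ, hγ⟩, by simpa [S, g] using hx⟩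
    rw [← iUnion_disjointed] at h1
    exact Set.mem_iUnion.1 h1
  · intro k x hx
    exact Set.mem_smul_set_iff_inv_smul_mem.1 (disjointed_subset S k hx)

end Partition

section Translate

variable {Γ : Type*} [Group Γ] {X : Type*} [MeasurableSpace X] [MulAction Γ X]
  [MeasurableConstSMul Γ X] {μ : Measure X} [SMulInvariantMeasure Γ X μ] {Z : Type*} [CommRing Z]

/-- The translate `γ • S` of a measurable set. -/
def smulSet (γ : Γ) (S : {S : Set X // MeasurableSet S}) : {S : Set X // MeasurableSet S} :=
  ⟨(fun x => γ⁻¹ • x) ⁻¹' S.1, measurable_const_smul γ⁻¹ S.2⟩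

theorem smul_chi (γ : Γ) (S : {S : Set X // MeasurableSet S}) :
    γ • LInfty.chi Z μ S = LInfty.chi Z μ (smulSet γ S) := by
  unfold LInfty.chi
  rw [smul_mk]
  congr 1

/-- The intersection of measurable sets. -/
def interSet (S S' : {S : Set X // MeasurableSet S}) : {S : Set X // MeasurableSet S} :=
  ⟨S.1 ∩ S'.1, S.2.inter S'.2⟩

theorem chi_mul_chi_inter (S S' : {S : Set X // MeasurableSet S}) :
    LInfty.chi Z μ S * LInfty.chi Z μ S' = LInfty.chi Z μ (interSet S S') := by
  unfold LInfty.chi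
  rw [← map_mul]
  congr 1
  ext x
  by_cases h : x ∈ S.1 <;> by_cases h' : x ∈ S'.1 <;> simp [interSet, h, h']

theorem chi_mul_chi_of_disjoint {S S' : {S : Set X // MeasurableSet S}}
    (h : Disjoint S.1 S'.1) : LInfty.chi Z μ S * LInfty.chi Z μ S' = 0 := by
  unfold LInfty.chi
  rw [← map_mul, ← map_zero (LInfty.mk Z μ)]
  congr 1
  ext x
  by_cases hx : x ∈ S.1
  · simp [hx, Set.disjoint_left.1 h hx]
  · simp [hx]

theorem single_mul_chiRing (γ : Γ) (S : {S : Set X // MeasurableSet S}) :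
    (SkewMonoidAlgebra.single γ 1 : Crossed Γ Z μ) * chiRing Γ Z μ S =
      chiRing Γ Z μ (smulSet γ S) * SkewMonoidAlgebra.single γ 1 := by
  rw [chiRing, chiRing, SkewMonoidAlgebra.single_mul_single, SkewMonoidAlgebra.single_mul_single,
    one_smul, smul_chi, one_mul, mul_one, one_mul, mul_one]

theorem single_inv_mul_single (γ : Γ) :
    (SkewMonoidAlgebra.single γ⁻¹ 1 : Crossed Γ Z μ) * SkewMonoidAlgebra.single γ 1 = 1 := by
  rw [SkewMonoidAlgebra.single_mul_single, smul_one, one_mul, inv_mul_cancel,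
    SkewMonoidAlgebra.one_def]

theorem single_mul_single_inv (γ : Γ) :
    (SkewMonoidAlgebra.single γ 1 : Crossed Γ Z μ) * SkewMonoidAlgebra.single γ⁻¹ 1 = 1 := by
  rw [SkewMonoidAlgebra.single_mul_single, smul_one, one_mul, mul_inv_cancel,
    SkewMonoidAlgebra.one_def]

theorem chiRing_mul_self (S : {S : Set X // MeasurableSet S}) :
    chiRing Γ Z μ S * chiRing Γ Z μ S = chiRing Γ Z μ S := chiRing_mul_of_le le_rfl

theorem smulSet_smulSet_inv (γ : Γ) (S : {S : Set X // MeasurableSet S}) :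
    smulSet γ (smulSet γ⁻¹ S) = S := by
  refine Subtype.ext (Set.ext fun x => ?_)
  simp [smulSet]

variable {A : {S : Set X // MeasurableSet S}} (Q : TranslatePartition Γ μ A.1)

namespace TranslatePartition

theorem sum_chi : ∑ k, LInfty.chi Z μ (Q.P k) = 1 := by
  unfold LInfty.chi
  rw [← map_sum, ← map_one (LInfty.mk Z μ), LInfty.mk_eq_mk]
  filter_upwards [Q.cover] with x ⟨k, hk⟩
  rw [simpleFunc_sum_apply, Finset.sum_eq_single_of_mem k (Finset.mem_univ k)]
  · simp [hk]
  · intro l _ hl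
    have : x ∉ (Q.P l).1 := fun h => Set.disjoint_left.1 (Q.disjoint hl) h hk
    simp [this]

variable (Z) in
/-- The element `χ_{P k} g_k`, which maps functions on `A` to functions on `P k`. -/
def into (k : Fin Q.num) : Crossed Γ Z μ :=
  chiRing Γ Z μ (Q.P k) * SkewMonoidAlgebra.single (Q.g k) 1

variable (Z) in
/-- The element `g_k⁻¹ χ_{P k}`, which maps functions on `P k` to functions on `A`. -/
def back (k : Fin Q.num) : Crossed Γ Z μ :=
  SkewMonoidAlgebra.single (Q.g k)⁻¹ 1 * chiRing Γ Z μ (Q.P k)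

theorem sum_chiRing : ∑ k, chiRing Γ Z μ (Q.P k) = 1 := by
  have h := congrArg (SkewMonoidAlgebra.single (1 : Γ)) (Q.sum_chi (Z := Z))
  rw [SkewMonoidAlgebra.one_def, ← h]
  exact (map_sum (SkewMonoidAlgebra.singleAddHom (1 : Γ)) _ _).symm

theorem into_mul_back (k : Fin Q.num) : Q.into Z k * Q.back Z k = chiRing Γ Z μ (Q.P k) := by
  rw [into, back, mul_assoc, ← mul_assoc (SkewMonoidAlgebra.single _ _),
    single_mul_single_inv, one_mul, chiRing_mul_self]

theorem sum_into_mul_back : ∑ k, Q.into Z k * Q.back Z k = 1 := by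
  simp only [into_mul_back, sum_chiRing]

theorem back_eq (k : Fin Q.num) : Q.back Z k =
    chiRing Γ Z μ (smulSet (Q.g k)⁻¹ (Q.P k)) * SkewMonoidAlgebra.single (Q.g k)⁻¹ 1 := by
  rw [back, single_mul_chiRing]

theorem into_eq (k : Fin Q.num) : Q.into Z k =
    SkewMonoidAlgebra.single (Q.g k) 1 * chiRing Γ Z μ (smulSet (Q.g k)⁻¹ (Q.P k)) := by
  rw [into, single_mul_chiRing, smulSet_smulSet_inv]

theorem smulSet_le (k : Fin Q.num) : smulSet (Q.g k)⁻¹ (Q.P k) ≤ A := by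
  intro x hx
  have h := Q.mem k _ hx
  simpa using h

theorem chiRing_mul_back (k : Fin Q.num) : chiRing Γ Z μ A * Q.back Z k = Q.back Z k := by
  rw [back_eq, ← mul_assoc, chiRing_mul_of_ge (Q.smulSet_le k)]

theorem into_mul_chiRing (k : Fin Q.num) : Q.into Z k * chiRing Γ Z μ A = Q.into Z k := by
  rw [into_eq, mul_assoc, chiRing_mul_of_le (Q.smulSet_le k)]

theorem back_mul_into (k : Fin Q.num) :
    Q.back Z k * Q.into Z k = chiRing Γ Z μ (smulSet (Q.g k)⁻¹ (Q.P k)) := by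
  rw [back_eq, into_eq, mul_assoc, ← mul_assoc (SkewMonoidAlgebra.single _ _),
    single_inv_mul_single, one_mul, chiRing_mul_self]

theorem back_mul_into_of_ne {k l : Fin Q.num} (h : k ≠ l) : Q.back Z k * Q.into Z l = 0 := by
  rw [back, into, mul_assoc, ← mul_assoc (chiRing Γ Z μ _)]
  rw [chiRing, chiRing, SkewMonoidAlgebra.single_mul_single, one_smul,
    chi_mul_chi_of_disjoint (Q.disjoint h), SkewMonoidAlgebra.single_zero, zero_mul, mul_zero]

/-- The part `g_k⁻¹ (S ∩ P k)` of `A` that corresponds to the piece `S ∩ P k` of `S`. -/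
def part (k : Fin Q.num) (S : {S : Set X // MeasurableSet S}) : {S : Set X // MeasurableSet S} :=
  smulSet (Q.g k)⁻¹ (interSet S (Q.P k))

theorem part_le (k : Fin Q.num) (S : {S : Set X // MeasurableSet S}) : Q.part k S ≤ A := by
  intro x hx
  have h := Q.mem k _ (Set.mem_of_mem_inter_right hx)
  simpa using h

theorem chiRing_mul_into (k : Fin Q.num) (S : {S : Set X // MeasurableSet S}) :
    chiRing Γ Z μ S * Q.into Z k = Q.into Z k * chiRing Γ Z μ (Q.part k S) := by
  have h1 : chiRing Γ Z μ S * chiRing Γ Z μ (Q.P k) = chiRing Γ Z μ (interSet S (Q.P k)) := by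
    rw [chiRing, chiRing, SkewMonoidAlgebra.single_mul_single, one_smul, chi_mul_chi_inter,
      one_mul, chiRing]
  have h2 : interSet S (Q.P k) ≤ Q.P k := Set.inter_subset_right
  rw [into, ← mul_assoc, h1, mul_assoc, part, single_mul_chiRing, smulSet_smulSet_inv,
    ← mul_assoc, chiRing_mul_of_ge h2]

theorem back_mul_chiRing_mul_into (k : Fin Q.num) (S : {S : Set X // MeasurableSet S}) :
    Q.back Z k * chiRing Γ Z μ S * Q.into Z k = chiRing Γ Z μ (Q.part k S) := by
  rw [mul_assoc, chiRing_mul_into, ← mul_assoc, back_mul_into, chiRing_mul_of_ge]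
  intro x hx
  exact Set.mem_of_mem_inter_right hx

theorem back_mul_chiRing_mul_into_of_ne {k l : Fin Q.num} (h : k ≠ l)
    (S : {S : Set X // MeasurableSet S}) :
    Q.back Z k * chiRing Γ Z μ S * Q.into Z l = 0 := by
  rw [mul_assoc, chiRing_mul_into, ← mul_assoc, back_mul_into_of_ne _ h, zero_mul]

theorem sum_real_part [IsFiniteMeasure μ] (S : {S : Set X // MeasurableSet S}) :
    ∑ k, μ.real (Q.part k S).1 = μ.real S.1 := by
  have h1 : ∀ k, μ.real (Q.part k S).1 = μ.real (S.1 ∩ (Q.P k).1) := fun k =>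
    (measurePreserving_smul ((Q.g k)⁻¹)⁻¹ μ).measureReal_preimage
      (S.2.inter (Q.P k).2).nullMeasurableSet
  simp only [h1]
  rw [← measureReal_iUnion_fintype]
  · refine measureReal_congr ?_
    filter_upwards [Q.cover] with x ⟨k, hk⟩
    refine propext ⟨fun hx => ?_, fun hx => ?_⟩
    · obtain ⟨l, hl⟩ := Set.mem_iUnion.1 hx
      exact hl.1
    · exact Set.mem_iUnion.2 ⟨k, hx, hk⟩
  · exact fun k l hkl => (Q.disjoint hkl).mono Set.inter_subset_right Set.inter_subset_right
  · exact fun k => S.2.inter (Q.P k).2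

end TranslatePartition

end Translate

/-! ### The `ℓ¹`-norm on the crossed product -/

section Norm

variable {X : Type*} [MeasurableSpace X] {μ : Measure X}

theorem LInfty.l1_nonneg (a : LInfty ℤ μ) : 0 ≤ LInfty.l1 μ a := by
  obtain ⟨f, rfl⟩ := LInfty.mk_surjective ℤ μ a
  exact integral_nonneg fun x => abs_nonneg _

theorem LInfty.l1_zero : LInfty.l1 μ 0 = 0 := by
  rw [← map_zero (LInfty.mk ℤ μ), LInfty.l1_mk]
  simp

theorem integrable_abs_simpleFunc [IsFiniteMeasure μ] (f : SimpleFunc X ℤ) :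
    Integrable (fun x => |(f x : ℝ)|) μ :=
  SimpleFunc.integrable_of_isFiniteMeasure (μ := μ) (f.map fun z : ℤ => |(z : ℝ)|)

theorem LInfty.l1_add_le [IsFiniteMeasure μ] (a b : LInfty ℤ μ) :
    LInfty.l1 μ (a + b) ≤ LInfty.l1 μ a + LInfty.l1 μ b := by
  obtain ⟨f, rfl⟩ := LInfty.mk_surjective ℤ μ a
  obtain ⟨g, rfl⟩ := LInfty.mk_surjective ℤ μ b
  rw [← map_add, LInfty.l1_mk, LInfty.l1_mk, LInfty.l1_mk,
    ← integral_add (integrable_abs_simpleFunc f) (integrable_abs_simpleFunc g)]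
  refine integral_mono (integrable_abs_simpleFunc _)
    ((integrable_abs_simpleFunc f).add (integrable_abs_simpleFunc g)) fun x => ?_
  simp only [SimpleFunc.add_apply, Int.cast_add]
  exact abs_add_le _ _

theorem LInfty.sum_l1_chi_mul [IsFiniteMeasure μ] {κ : Type*} [Fintype κ]
    (P : κ → {S : Set X // MeasurableSet S}) (hd : Pairwise fun k l => Disjoint (P k).1 (P l).1)
    (hc : ∀ᵐ x ∂μ, ∃ k, x ∈ (P k).1) (a : LInfty ℤ μ) :
    ∑ k, LInfty.l1 μ (LInfty.chi ℤ μ (P k) * a) = LInfty.l1 μ a := by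
  obtain ⟨f, rfl⟩ := LInfty.mk_surjective ℤ μ a
  unfold LInfty.chi
  simp only [← map_mul, LInfty.l1_mk]
  rw [← integral_finsetSum _ fun k _ => integrable_abs_simpleFunc _]
  refine integral_congr_ae ?_
  filter_upwards [hc] with x ⟨k, hk⟩
  rw [Finset.sum_eq_single_of_mem k (Finset.mem_univ k)]
  · simp [hk]
  · intro l _ hl
    have : x ∉ (P l).1 := fun h => Set.disjoint_left.1 (hd hl) h hk
    simp [this]

variable {Γ : Type*} [Group Γ] [MulAction Γ X] [MeasurableConstSMul Γ X]
  [SMulInvariantMeasure Γ X μ]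

theorem LInfty.l1_smul (γ : Γ) (a : LInfty ℤ μ) : LInfty.l1 μ (γ • a) = LInfty.l1 μ a := by
  obtain ⟨f, rfl⟩ := LInfty.mk_surjective ℤ μ a
  rw [smul_mk, LInfty.l1_mk, LInfty.l1_mk]
  have hemb : MeasurableEmbedding fun x : X => γ⁻¹ • x := measurableEmbedding_const_smul γ⁻¹
  exact (measurePreserving_smul γ⁻¹ μ).integral_comp hemb (fun x => |(f x : ℝ)|)

theorem ringNorm_nonneg (r : Crossed Γ ℤ μ) : 0 ≤ ringNorm r :=
  Finset.sum_nonneg fun _ _ => LInfty.l1_nonneg _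

theorem ringNorm_eq_sum (r : Crossed Γ ℤ μ) {s : Finset Γ} (h : r.support ⊆ s) :
    ringNorm r = ∑ γ ∈ s, LInfty.l1 μ (r.coeff γ) :=
  Finsupp.sum_of_support_subset _ h _ fun _ _ => LInfty.l1_zero

theorem ringNorm_zero : ringNorm (0 : Crossed Γ ℤ μ) = 0 := by
  rw [ringNorm_eq_sum 0 (s := ∅) (by simp), Finset.sum_empty]

theorem ringNorm_single (γ : Γ) (a : LInfty ℤ μ) :
    ringNorm (SkewMonoidAlgebra.single γ a : Crossed Γ ℤ μ) = LInfty.l1 μ a := by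
  rw [ringNorm_eq_sum (s := {γ}) _ SkewMonoidAlgebra.support_single_subset, Finset.sum_singleton,
    SkewMonoidAlgebra.coeff_single, Finsupp.single_eq_same]

theorem ringNorm_add_le [IsFiniteMeasure μ] (r s : Crossed Γ ℤ μ) :
    ringNorm (r + s) ≤ ringNorm r + ringNorm s := by
  classical
  rw [ringNorm_eq_sum (r + s) SkewMonoidAlgebra.support_add,
    ringNorm_eq_sum r Finset.subset_union_left, ringNorm_eq_sum s Finset.subset_union_right,
    ← Finset.sum_add_distrib]
  refine Finset.sum_le_sum fun γ _ => ?_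
  rw [SkewMonoidAlgebra.coeff_add, Finsupp.add_apply]
  exact LInfty.l1_add_le _ _

theorem ringNorm_sum_le [IsFiniteMeasure μ] {κ : Type*} (s : Finset κ) (r : κ → Crossed Γ ℤ μ) :
    ringNorm (∑ k ∈ s, r k) ≤ ∑ k ∈ s, ringNorm (r k) := by
  classical
  induction s using Finset.induction_on with
  | empty => simp [ringNorm_zero]
  | insert a s ha ih =>
    rw [Finset.sum_insert ha, Finset.sum_insert ha]
    exact (ringNorm_add_le _ _).trans (by gcongr)

/-- If the norms of the coefficients add up, then so do the norms of the elements. -/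
theorem sum_ringNorm_of_coeff {κ : Type*} [Fintype κ] (s : κ → Crossed Γ ℤ μ)
    (r : Crossed Γ ℤ μ)
    (h : ∀ γ, ∑ k, LInfty.l1 μ ((s k).coeff γ) = LInfty.l1 μ (r.coeff γ)) :
    ∑ k, ringNorm (s k) = ringNorm r := by
  classical
  let t : Finset Γ := r.support ∪ Finset.univ.biUnion fun k => (s k).support
  have ht : ∀ k, (s k).support ⊆ t := fun k =>
    (Finset.subset_biUnion_of_mem (fun k => (s k).support) (Finset.mem_univ k)).trans
      Finset.subset_union_right
  rw [ringNorm_eq_sum r (s := t) Finset.subset_union_left,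
    Finset.sum_congr rfl fun k _ => ringNorm_eq_sum (s k) (ht k), Finset.sum_comm]
  exact Finset.sum_congr rfl fun γ _ => h γ

theorem ringNorm_single_mul_le [IsFiniteMeasure μ] (γ : Γ) (r : Crossed Γ ℤ μ) :
    ringNorm (SkewMonoidAlgebra.single γ 1 * r) ≤ ringNorm r := by
  conv_lhs => rw [← SkewMonoidAlgebra.sum_single r, SkewMonoidAlgebra.sum_def', Finset.mul_sum]
  refine (ringNorm_sum_le _ _).trans (le_of_eq ?_)
  rw [ringNorm_eq_sum r subset_rfl]
  refine Finset.sum_congr rfl fun δ _ => ?_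
  rw [SkewMonoidAlgebra.single_mul_single, ringNorm_single, one_mul, LInfty.l1_smul]

theorem ringNorm_mul_single_le [IsFiniteMeasure μ] (γ : Γ) (r : Crossed Γ ℤ μ) :
    ringNorm (r * SkewMonoidAlgebra.single γ 1) ≤ ringNorm r := by
  conv_lhs => rw [← SkewMonoidAlgebra.sum_single r, SkewMonoidAlgebra.sum_def', Finset.sum_mul]
  refine (ringNorm_sum_le _ _).trans (le_of_eq ?_)
  rw [ringNorm_eq_sum r subset_rfl]
  refine Finset.sum_congr rfl fun δ _ => ?_
  rw [SkewMonoidAlgebra.single_mul_single, ringNorm_single, smul_one, mul_one]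

theorem ringNorm_single_mul [IsFiniteMeasure μ] (γ : Γ) (r : Crossed Γ ℤ μ) :
    ringNorm (SkewMonoidAlgebra.single γ 1 * r) = ringNorm r := by
  refine le_antisymm (ringNorm_single_mul_le γ r) ?_
  have h := ringNorm_single_mul_le γ⁻¹ (SkewMonoidAlgebra.single γ 1 * r)
  rwa [← mul_assoc, single_inv_mul_single, one_mul] at h

theorem ringNorm_mul_single [IsFiniteMeasure μ] (γ : Γ) (r : Crossed Γ ℤ μ) :
    ringNorm (r * SkewMonoidAlgebra.single γ 1) = ringNorm r := by
  refine le_antisymm (ringNorm_mul_single_le γ r) ?_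
  have h := ringNorm_mul_single_le γ⁻¹ (r * SkewMonoidAlgebra.single γ 1)
  rwa [mul_assoc, single_mul_single_inv, mul_one] at h

variable [IsFiniteMeasure μ] {A : {S : Set X // MeasurableSet S}}
  (Q : TranslatePartition Γ μ A.1)

theorem TranslatePartition.sum_ringNorm_back_mul (r : Crossed Γ ℤ μ) :
    ∑ k, ringNorm (Q.back ℤ k * r) = ringNorm r := by
  refine Eq.trans (Finset.sum_congr rfl fun k _ => ?_) (sum_ringNorm_of_coeff
    (fun k => chiRing Γ ℤ μ (Q.P k) * r) r fun γ => ?_)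
  · rw [back, mul_assoc, ringNorm_single_mul]
  · simp only [chiRing, SkewMonoidAlgebra.coeff_single_one_mul]
    exact LInfty.sum_l1_chi_mul Q.P Q.disjoint Q.cover _

theorem TranslatePartition.sum_ringNorm_mul_into (r : Crossed Γ ℤ μ) :
    ∑ k, ringNorm (r * Q.into ℤ k) = ringNorm r := by
  refine Eq.trans (Finset.sum_congr rfl fun k _ => ?_) (sum_ringNorm_of_coeff
    (fun k => r * chiRing Γ ℤ μ (Q.P k)) r fun γ => ?_)
  · rw [into, ← mul_assoc, ringNorm_mul_single]
  · simp only [chiRing, SkewMonoidAlgebra.coeff_mul_single_one, smul_chi]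
    simp only [mul_comm (r.coeff γ)]
    refine LInfty.sum_l1_chi_mul (fun k => smulSet γ (Q.P k)) ?_ ?_ _
    · exact fun k l hkl => (Q.disjoint hkl).preimage _
    · exact (measurePreserving_smul γ⁻¹ μ).quasiMeasurePreserving.ae Q.cover

end Norm

/-! ### Transport scales the norm by the inverse of the index -/

namespace BoundedOE

section Norm

variable {Γ Λ : Type*} [Group Γ] [Group Λ] {X Y : Type*} [MeasurableSpace X]
  [MeasurableSpace Y] [StandardBorelSpace X] [StandardBorelSpace Y]
  [MulAction Γ X] [MulAction Λ Y] [MeasurableConstSMul Γ X] [MeasurableConstSMul Λ Y]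
  {μ : Measure X} {ν : Measure Y} [IsFiniteMeasure μ] [IsFiniteMeasure ν]
  [SMulInvariantMeasure Γ X μ] [SMulInvariantMeasure Λ Y ν]
  {c : ℝ} (T : BoundedOE Γ Λ μ ν c)

theorem integral_comp_q (f : SimpleFunc X ℤ) :
    ∫ y in T.B, |(f (T.q y) : ℝ)| ∂ν = c⁻¹ * ∫ x in T.A, |(f x : ℝ)| ∂μ := by
  have h : ∫ x, |(f x : ℝ)| ∂((ν.restrict T.B).map T.q) =
      ∫ y in T.B, |(f (T.q y) : ℝ)| ∂ν :=
    integral_map T.measurable_q.aemeasurable (integrable_abs_simpleFunc f).aestronglyMeasurable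
  rw [← h, T.map_q, integral_smul_measure, ENNReal.toReal_ofReal (inv_pos.2 T.pos).le, smul_eq_mul]

theorem ringNorm_ringPush_single_le (γ : Γ) (a : LInfty ℤ μ) :
    ringNorm (T.ringPush (SkewMonoidAlgebra.single γ a)) ≤ c⁻¹ * LInfty.l1 μ a := by
  obtain ⟨f, rfl⟩ := LInfty.mk_surjective ℤ μ a
  obtain ⟨F, hF⟩ := T.exists_finset_piece γ
  have h : T.ringPush (SkewMonoidAlgebra.single γ (LInfty.mk ℤ μ f)) =
      ∑ l ∈ F, SkewMonoidAlgebra.single l⁻¹ (LInfty.mk ℤ ν (T.pieceCoeff γ l f)) :=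
    eq_of_smul_eq_smul T.free_right fun b => by
      rw [ringPush_smul, T.single_transport γ f F hF]
  rw [h, LInfty.l1_mk]
  calc _ ≤ ∑ l ∈ F, ∫ y, |(T.pieceCoeff γ l f y : ℝ)| ∂ν := by
        refine (ringNorm_sum_le _ _).trans (le_of_eq (Finset.sum_congr rfl fun l _ => ?_))
        rw [ringNorm_single, LInfty.l1_mk]
    _ = ∫ y, ∑ l ∈ F, |(T.pieceCoeff γ l f y : ℝ)| ∂ν :=
        (integral_finsetSum _ fun l _ => integrable_abs_simpleFunc _).symm
    _ ≤ ∫ y, T.B.indicator (fun y => |(f (T.q y) : ℝ)|) y ∂ν := by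
        refine integral_mono_ae (integrable_finsetSum _ fun l _ => integrable_abs_simpleFunc _)
          ((integrable_abs_simpleFunc (f.comp T.q T.measurable_q)).indicator T.measurableSet_B) ?_
        filter_upwards [hF] with y hy
        by_cases hex : ∃ l, y ∈ T.piece γ l
        · obtain ⟨l, hl⟩ := hex
          rw [Set.indicator_of_mem hl.1]
          have h0 : ∀ l' ∈ F, l' ≠ l → |(T.pieceCoeff γ l' f y : ℝ)| = 0 := fun l' _ hne => by
            rw [T.pieceCoeff_of_notMem f fun h => hne (hy.2 l' l h hl), Int.cast_zero, abs_zero]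
          by_cases hlF : l ∈ F
          · rw [Finset.sum_eq_single_of_mem l hlF h0, T.pieceCoeff_of_mem f hl]
          · rw [Finset.sum_eq_zero fun l' hl' => h0 l' hl' fun h => hlF (h ▸ hl')]
            exact abs_nonneg _
        · push Not at hex
          rw [Finset.sum_eq_zero fun l _ => by
            rw [T.pieceCoeff_of_notMem f (hex l), Int.cast_zero, abs_zero]]
          exact Set.indicator_nonneg (fun _ _ => abs_nonneg _) _
    _ = c⁻¹ * ∫ x in T.A, |(f x : ℝ)| ∂μ := by
        rw [integral_indicator T.measurableSet_B, integral_comp_q]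
    _ ≤ c⁻¹ * ∫ x, |(f x : ℝ)| ∂μ := by
        refine mul_le_mul_of_nonneg_left ?_ (inv_pos.2 T.pos).le
        exact setIntegral_le_integral (integrable_abs_simpleFunc f)
          (Filter.Eventually.of_forall fun _ => abs_nonneg _)

theorem ringNorm_ringPush_le (r : Crossed Γ ℤ μ) :
    ringNorm (T.ringPush r) ≤ c⁻¹ * ringNorm r := by
  conv_lhs => rw [← SkewMonoidAlgebra.sum_single r, SkewMonoidAlgebra.sum_def', map_sum]
  refine (ringNorm_sum_le _ _).trans ?_
  rw [ringNorm_eq_sum r subset_rfl, Finset.mul_sum]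
  exact Finset.sum_le_sum fun γ _ => T.ringNorm_ringPush_single_le γ _

/-- On the corner ring the transport scales the norm exactly: the upper bound applies to the
inverse transport as well. -/
theorem ringNorm_ringPush {r : Crossed Γ ℤ μ}
    (h : chiRing Γ ℤ μ T.dom * r * chiRing Γ ℤ μ T.dom = r) :
    ringNorm (T.ringPush r) = c⁻¹ * ringNorm r := by
  refine le_antisymm (T.ringNorm_ringPush_le r) ?_
  have h1 := T.symm.ringNorm_ringPush_le (T.ringPush r)
  rw [T.ringPush_symm_ringPush, h, inv_inv] at h1
  rw [inv_mul_le_iff₀ T.pos]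
  exact h1

end Norm

end BoundedOE

/-! ### Elements of marked projective modules -/

section Marked

variable {Γ : Type*} [Group Γ] {X : Type*} [MeasurableSpace X] [MulAction Γ X]
  [MeasurableConstSMul Γ X] {Z : Type*} [CommRing Z] {μ : Measure X} [SMulInvariantMeasure Γ X μ]
  {ι κ : Type}

theorem mem_marked_iff {A : Marking X ι} {z : ι → Crossed Γ Z μ} :
    z ∈ marked Γ Z μ A ↔ ∀ i, z i * chiRing Γ Z μ (A i) = z i := by
  rw [marked, Submodule.mem_pi]
  refine ⟨fun h i => ?_, fun h i _ => ?_⟩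
  · obtain ⟨r, hr⟩ := Submodule.mem_span_singleton.1 (h i (Set.mem_univ i))
    rw [← hr, smul_eq_mul, mul_assoc]
    exact congrArg _ (chiRing_mul_self (A i))
  · exact Submodule.mem_span_singleton.2 ⟨z i, h i⟩

variable [DecidableEq ι]

/-- The canonical generators of a marked projective module. -/
def gen (A : Marking X ι) (i : ι) : marked Γ Z μ A :=
  ⟨Pi.single i (chiRing Γ Z μ (A i)), mem_marked_iff.2 fun j => by
    by_cases h : j = i
    · subst h
      rw [Pi.single_eq_same, chiRing_mul_self]
    · rw [Pi.single_eq_of_ne h, zero_mul]⟩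

variable [Fintype ι]

theorem eq_sum_gen (A : Marking X ι) (z : marked Γ Z μ A) :
    z = ∑ i, (z : ι → Crossed Γ Z μ) i • gen A i := by
  refine Subtype.ext (funext fun j => ?_)
  rw [Submodule.coe_sum, Finset.sum_apply, Finset.sum_eq_single_of_mem j (Finset.mem_univ j)]
  · change _ = (z : ι → Crossed Γ Z μ) j *
      Pi.single (M := fun _ => Crossed Γ Z μ) j (chiRing Γ Z μ (A j)) j
    rw [Pi.single_eq_same, mem_marked_iff.1 z.2 j]
  · intro i _ hij
    change (z : ι → Crossed Γ Z μ) i *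
      Pi.single (M := fun _ => Crossed Γ Z μ) i (chiRing Γ Z μ (A i)) j = 0
    rw [Pi.single_eq_of_ne hij.symm, mul_zero]

end Marked

/-! ### Transport of marked projective modules and their homomorphisms -/

namespace BoundedOE

section Modules

variable {Γ Λ : Type*} [Group Γ] [Group Λ] {X Y : Type*} [MeasurableSpace X]
  [MeasurableSpace Y] [StandardBorelSpace X] [StandardBorelSpace Y]
  [MulAction Γ X] [MulAction Λ Y] [MeasurableConstSMul Γ X] [MeasurableConstSMul Λ Y]
  {μ : Measure X} {ν : Measure Y} [SMulInvariantMeasure Γ X μ] [SMulInvariantMeasure Λ Y ν]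
  {c : ℝ} (T : BoundedOE Γ Λ μ ν c) {Z : Type*} [CommRing Z]

theorem dom_mul_ringPush (r : Crossed Γ Z μ) :
    chiRing Λ Z ν T.symm.dom * T.ringPush r = T.ringPush r := by
  rw [← ringPush_one, ← ringPush_mul_dom, one_mul, ringPush_dom_mul]

variable (Z) in
/-- An additive map from an `R_α`-module to an `R_β`-module is compatible if it is equivariant for
the corner ring of `A` along the transport of crossed products. -/
def Compatible {N N' : Type*} [AddCommGroup N] [AddCommGroup N'] [Module (Crossed Γ Z μ) N]
    [Module (Crossed Λ Z ν) N'] (s : N →+ N') : Prop :=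
  ∀ (r : Crossed Γ Z μ) (n : N),
    s (r • chiRing Γ Z μ T.dom • n) = T.ringPush r • s n

theorem compatible_push : T.Compatible Z (T.push : LInfty Z μ →+ LInfty Z ν) := fun r a => by
  rw [← mul_smul, push_smul_dom]

variable (Q : TranslatePartition Γ μ T.dom.1) {m m₁ m₂ : ℕ}

/-- The transported marking. Every `A i` is cut into the pieces `A i ∩ P k`, which are translated
into the domain of the orbit equivalence and then mapped to `Y`; the index set of the pieces is
identified with an initial segment of the natural numbers. -/
def pushMarking (A : Marking X (Fin m)) : Marking Y (Fin (m * Q.num)) := fun j =>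
  T.image (Q.part (finProdFinEquiv.symm j).2 (A (finProdFinEquiv.symm j).1))

/-- The transport of elements of marked projective modules. -/
def pushModule (A : Marking X (Fin m)) :
    marked Γ Z μ A →+ marked Λ Z ν (T.pushMarking Q A) :=
  AddMonoidHom.mk' (fun z => ⟨fun j => T.ringPush
      ((z : Fin m → Crossed Γ Z μ) (finProdFinEquiv.symm j).1 *
        Q.into Z (finProdFinEquiv.symm j).2), by
    rw [mem_marked_iff]
    intro j
    rw [pushMarking, ← ringPush_chi, ← ringPush_mul_dom]
    conv_rhs => rw [← mem_marked_iff.1 z.2, mul_assoc, TranslatePartition.chiRing_mul_into]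
    rw [mul_assoc, mul_assoc, chiRing_mul_of_ge (Q.part_le _ _)]⟩) (by
    intro z w
    refine Subtype.ext (funext fun j => ?_)
    change T.ringPush (((z : Fin m → Crossed Γ Z μ) _ + (w : Fin m → Crossed Γ Z μ) _) * _) =
      T.ringPush _ + T.ringPush _
    rw [add_mul, map_add])

theorem pushModule_apply (A : Marking X (Fin m)) (z : marked Γ Z μ A) (j : Fin (m * Q.num)) :
    (T.pushModule Q A z : Fin (m * Q.num) → Crossed Λ Z ν) j = T.ringPush
      ((z : Fin m → Crossed Γ Z μ) (finProdFinEquiv.symm j).1 *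
        Q.into Z (finProdFinEquiv.symm j).2) := rfl

theorem compatible_pushModule (A : Marking X (Fin m)) :
    T.Compatible Z (T.pushModule Q A : marked Γ Z μ A →+ marked Λ Z ν (T.pushMarking Q A)) := by
  intro r z
  refine Subtype.ext (funext fun j => ?_)
  change T.ringPush ((r * (chiRing Γ Z μ T.dom * _)) * _) = T.ringPush r * T.ringPush _
  rw [← ringPush_mul_dom, mul_assoc, mul_assoc, mul_assoc]

theorem gen_pushMarking (A : Marking X (Fin m)) (j : Fin (m * Q.num)) :
    (gen (T.pushMarking Q A) j : marked Λ Z ν (T.pushMarking Q A)) =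
      T.pushModule Q A (Q.back Z (finProdFinEquiv.symm j).2 •
        gen A (finProdFinEquiv.symm j).1) := by
  refine Subtype.ext (funext fun j' => ?_)
  rw [pushModule_apply]
  change Pi.single (M := fun _ => Crossed Λ Z ν) j _ j' = T.ringPush ((Q.back Z _ *
    Pi.single (M := fun _ => Crossed Γ Z μ) _ (chiRing Γ Z μ (A _)) _) * _)
  by_cases h : j' = j
  · subst h
    rw [Pi.single_eq_same, Pi.single_eq_same, TranslatePartition.back_mul_chiRing_mul_into,
      ringPush_chi]
    rfl
  · rw [Pi.single_eq_of_ne h]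
    by_cases h1 : (finProdFinEquiv.symm j').1 = (finProdFinEquiv.symm j).1
    · have h2 : (finProdFinEquiv.symm j).2 ≠ (finProdFinEquiv.symm j').2 := fun h2 =>
        h (finProdFinEquiv.symm.injective (Prod.ext h1 h2.symm))
      rw [h1, Pi.single_eq_same, TranslatePartition.back_mul_chiRing_mul_into_of_ne _ h2, map_zero]
    · rw [Pi.single_eq_of_ne h1, mul_zero, zero_mul, map_zero]

theorem eq_sum_pushModule (A : Marking X (Fin m)) (z' : marked Λ Z ν (T.pushMarking Q A)) :
    z' = ∑ j, (z' : Fin (m * Q.num) → Crossed Λ Z ν) j •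
      T.pushModule Q A (Q.back Z (finProdFinEquiv.symm j).2 •
        gen A (finProdFinEquiv.symm j).1) := by
  conv_lhs => rw [eq_sum_gen _ z']
  exact Finset.sum_congr rfl fun j _ => by rw [gen_pushMarking]

/-- The pieces of `z` add up to `z`; this unwinds `∑ k, into k * back k = 1`. -/
theorem sum_back_gen (A : Marking X (Fin m)) (z : marked Γ Z μ A) :
    ∑ j : Fin (m * Q.num), ((z : Fin m → Crossed Γ Z μ) (finProdFinEquiv.symm j).1 *
      Q.into Z (finProdFinEquiv.symm j).2) • Q.back Z (finProdFinEquiv.symm j).2 •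
        gen A (finProdFinEquiv.symm j).1 = z := by
  rw [finProdFinEquiv.symm.sum_comp (fun ik : Fin m × Fin Q.num =>
    ((z : Fin m → Crossed Γ Z μ) ik.1 * Q.into Z ik.2) • Q.back Z ik.2 •
      (gen A ik.1 : marked Γ Z μ A)), Fintype.sum_prod_type]
  conv_rhs => rw [eq_sum_gen _ z]
  refine Finset.sum_congr rfl fun i _ => ?_
  simp only [← mul_smul, mul_assoc]
  rw [← Finset.sum_smul, ← Finset.mul_sum, TranslatePartition.sum_into_mul_back, mul_one]

/-- Every element of the part of the transported module over `B` is the transport of an element of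
the part over `A`. -/
theorem exists_pushModule_eq (A : Marking X (Fin m)) (z' : marked Λ Z ν (T.pushMarking Q A))
    (h : chiRing Λ Z ν T.symm.dom • z' = z') :
    ∃ z : marked Γ Z μ A, chiRing Γ Z μ T.dom • z = z ∧ T.pushModule Q A z = z' := by
  let w : Fin (m * Q.num) → marked Γ Z μ A := fun j =>
    Q.back Z (finProdFinEquiv.symm j).2 • gen A (finProdFinEquiv.symm j).1
  have hw : ∀ j, chiRing Γ Z μ T.dom • w j = w j := fun j => by
    rw [← mul_smul, TranslatePartition.chiRing_mul_back]
  refine ⟨∑ j, T.symm.ringPush ((z' : Fin (m * Q.num) → Crossed Λ Z ν) j) • w j, ?_, ?_⟩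
  · rw [Finset.smul_sum]
    refine Finset.sum_congr rfl fun j _ => ?_
    rw [← mul_smul]
    exact congrArg (· • w j) (T.symm.dom_mul_ringPush _)
  · rw [map_sum]
    conv_rhs => rw [T.eq_sum_pushModule Q A z']
    refine Finset.sum_congr rfl fun j _ => ?_
    have h1 := T.compatible_pushModule Q A (T.symm.ringPush
      ((z' : Fin (m * Q.num) → Crossed Λ Z ν) j)) (w j)
    rw [hw] at h1
    rw [h1]
    have h2 : T.ringPush (T.symm.ringPush ((z' : Fin (m * Q.num) → Crossed Λ Z ν) j)) =
        (z' : Fin (m * Q.num) → Crossed Λ Z ν) j * chiRing Λ Z ν T.symm.dom := by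
      refine (T.symm.ringPush_symm_ringPush _).trans ?_
      congr 1
      exact congrFun (congrArg Subtype.val h) j
    rw [h2, mul_smul]
    congr 1
    have h3 := T.compatible_pushModule Q A 1 (w j)
    rwa [hw, one_smul, ringPush_one, eq_comm] at h3

section Extend

variable {N N' : Type*} [AddCommGroup N] [AddCommGroup N'] [Module (Crossed Γ Z μ) N]
  [Module (Crossed Λ Z ν) N']

/-- The transport of a homomorphism out of a marked projective module along a compatible map of
the codomains. -/
def pushHom {A : Marking X (Fin m)} (f : marked Γ Z μ A →ₗ[Crossed Γ Z μ] N) (s : N →+ N') :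
    marked Λ Z ν (T.pushMarking Q A) →ₗ[Crossed Λ Z ν] N' where
  toFun z' := ∑ j, (z' : Fin (m * Q.num) → Crossed Λ Z ν) j • s (f
    (Q.back Z (finProdFinEquiv.symm j).2 • gen A (finProdFinEquiv.symm j).1))
  map_add' z w := by
    rw [← Finset.sum_add_distrib]
    exact Finset.sum_congr rfl fun j _ => add_smul _ _ _
  map_smul' r z := by
    rw [RingHom.id_apply, Finset.smul_sum]
    exact Finset.sum_congr rfl fun j _ => mul_smul _ _ _

theorem pushHom_apply {A : Marking X (Fin m)} (f : marked Γ Z μ A →ₗ[Crossed Γ Z μ] N)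
    (s : N →+ N') (z' : marked Λ Z ν (T.pushMarking Q A)) :
    T.pushHom Q f s z' = ∑ j, (z' : Fin (m * Q.num) → Crossed Λ Z ν) j • s (f
      (Q.back Z (finProdFinEquiv.symm j).2 • gen A (finProdFinEquiv.symm j).1)) := rfl

theorem pushHom_pushModule {A : Marking X (Fin m)} (f : marked Γ Z μ A →ₗ[Crossed Γ Z μ] N)
    {s : N →+ N'} (hs : T.Compatible Z s) (z : marked Γ Z μ A) :
    T.pushHom Q f s (T.pushModule Q A z) = s (f z) := by
  conv_rhs => rw [← T.sum_back_gen Q A z, map_sum, map_sum]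
  rw [pushHom_apply]
  refine Finset.sum_congr rfl fun j _ => ?_
  rw [pushModule_apply, ← hs]
  simp only [map_smul]
  rw [← mul_smul (chiRing Γ Z μ T.dom), TranslatePartition.chiRing_mul_back]

theorem hom_ext_pushModule {A : Marking X (Fin m)}
    {f g : marked Λ Z ν (T.pushMarking Q A) →ₗ[Crossed Λ Z ν] N'}
    (h : ∀ z, f (T.pushModule Q A z) = g (T.pushModule Q A z)) : f = g := by
  refine LinearMap.ext fun z' => ?_
  rw [T.eq_sum_pushModule Q A z', map_sum, map_sum]
  exact Finset.sum_congr rfl fun j _ => by rw [f.map_smul, g.map_smul, h]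

end Extend

theorem dim_pushMarking [IsFiniteMeasure μ] (A : Marking X (Fin m)) :
    dim ν (T.pushMarking Q A) = c⁻¹ * dim μ A := by
  have h : ∀ j : Fin (m * Q.num), ν.real (T.pushMarking Q A j).1 =
      c⁻¹ * μ.real (Q.part (finProdFinEquiv.symm j).2 (A (finProdFinEquiv.symm j).1)).1 := by
    intro j
    rw [pushMarking, real_image]
    congr 2
    exact Set.inter_eq_right.2 (Q.part_le _ _)
  rw [dim, dim, Finset.sum_congr rfl fun j _ => h j, ← Finset.mul_sum,
    finProdFinEquiv.symm.sum_comp (fun ik : Fin m × Fin Q.num =>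
      μ.real (Q.part ik.2 (A ik.1)).1), Fintype.sum_prod_type]
  simp only [TranslatePartition.sum_real_part]

theorem pushMarking_mono {A A' : Marking X (Fin m)} (h : A' ≤ A) :
    T.pushMarking Q A' ≤ T.pushMarking Q A := by
  intro j y hy
  exact ⟨hy.1, h _ hy.2.1, hy.2.2⟩

end Modules

section Norm

variable {Γ Λ : Type*} [Group Γ] [Group Λ] {X Y : Type*} [MeasurableSpace X]
  [MeasurableSpace Y] [StandardBorelSpace X] [StandardBorelSpace Y]
  [MulAction Γ X] [MulAction Λ Y] [MeasurableConstSMul Γ X] [MeasurableConstSMul Λ Y]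
  {μ : Measure X} {ν : Measure Y} [IsFiniteMeasure μ] [IsFiniteMeasure ν]
  [SMulInvariantMeasure Γ X μ] [SMulInvariantMeasure Λ Y ν]
  {c : ℝ} (T : BoundedOE Γ Λ μ ν c) (Q : TranslatePartition Γ μ T.dom.1) {m m₁ m₂ : ℕ}

theorem l1Norm_pushModule {A : Marking X (Fin m)} (z : marked Γ ℤ μ A)
    (hz : chiRing Γ ℤ μ T.dom • z = z) :
    l1Norm (T.pushModule Q A z : Fin (m * Q.num) → Crossed Λ ℤ ν) =
      c⁻¹ * l1Norm (z : Fin m → Crossed Γ ℤ μ) := by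
  have h : ∀ i k, ringNorm (T.ringPush ((z : Fin m → Crossed Γ ℤ μ) i * Q.into ℤ k)) =
      c⁻¹ * ringNorm ((z : Fin m → Crossed Γ ℤ μ) i * Q.into ℤ k) := by
    intro i k
    refine T.ringNorm_ringPush ?_
    rw [mul_assoc, mul_assoc, TranslatePartition.into_mul_chiRing, ← mul_assoc]
    congr 1
    exact congrFun (congrArg Subtype.val hz) i
  rw [l1Norm, l1Norm]
  simp only [pushModule_apply, h]
  rw [← Finset.mul_sum, finProdFinEquiv.symm.sum_comp (fun ik : Fin m × Fin Q.num =>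
    ringNorm ((z : Fin m → Crossed Γ ℤ μ) ik.1 * Q.into ℤ ik.2)), Fintype.sum_prod_type]
  simp only [TranslatePartition.sum_ringNorm_mul_into]

end Norm

end BoundedOE

/-! ### The operator norm is detected over a cofinite set -/

section OpNorm

variable {Γ : Type*} [Group Γ] {X : Type*} [MeasurableSpace X] [MulAction Γ X]
  [MeasurableConstSMul Γ X] {μ : Measure X} [IsFiniteMeasure μ] [SMulInvariantMeasure Γ X μ]
  {ι κ : Type} [Fintype ι] [Fintype κ]

theorem l1Norm_sum_le {σ : Type*} (s : Finset σ) (z : σ → ι → Crossed Γ ℤ μ) :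
    l1Norm (∑ k ∈ s, z k) ≤ ∑ k ∈ s, l1Norm (z k) := by
  simp only [l1Norm, Finset.sum_apply]
  rw [Finset.sum_comm]
  exact Finset.sum_le_sum fun i _ => ringNorm_sum_le _ _

theorem TranslatePartition.sum_l1Norm_back_smul {A : {S : Set X // MeasurableSet S}}
    (Q : TranslatePartition Γ μ A.1) (z : ι → Crossed Γ ℤ μ) :
    ∑ k, l1Norm (Q.back ℤ k • z) = l1Norm z := by
  simp only [l1Norm]
  rw [Finset.sum_comm]
  exact Finset.sum_congr rfl fun i _ => Q.sum_ringNorm_back_mul _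

theorem TranslatePartition.l1Norm_into_smul_le {A : {S : Set X // MeasurableSet S}}
    (Q : TranslatePartition Γ μ A.1) (k : Fin Q.num) (z : ι → Crossed Γ ℤ μ) :
    l1Norm (Q.into ℤ k • z) ≤ l1Norm z := by
  rw [l1Norm, l1Norm]
  refine Finset.sum_le_sum fun i _ => ?_
  -- The norm of `χ g r` is that of `g⁻¹ χ g r`, one of the summands of `|g r| = |r|`.
  have h1 := Q.sum_ringNorm_back_mul (SkewMonoidAlgebra.single (Q.g k) 1 * z i)
  rw [ringNorm_single_mul] at h1
  rw [← h1]
  refine le_trans (le_of_eq ?_) (Finset.single_le_sum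
    (f := fun k' => ringNorm (Q.back ℤ k' * (SkewMonoidAlgebra.single (Q.g k) 1 * z i)))
    (fun _ _ => ringNorm_nonneg _) (Finset.mem_univ k))
  change ringNorm (chiRing Γ ℤ μ (Q.P k) * SkewMonoidAlgebra.single (Q.g k) 1 * z i) =
    ringNorm (SkewMonoidAlgebra.single (Q.g k)⁻¹ 1 * chiRing Γ ℤ μ (Q.P k) *
      (SkewMonoidAlgebra.single (Q.g k) 1 * z i))
  rw [mul_assoc (SkewMonoidAlgebra.single (Q.g k)⁻¹ 1), ringNorm_single_mul, mul_assoc]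

/-- A bound for a homomorphism on the elements supported over `A` is a bound everywhere, as every
element is an `ℓ¹`-orthogonal sum of translates of such elements. -/
theorem bound_of_bound_on_corner {A : {S : Set X // MeasurableSet S}}
    (Q : TranslatePartition Γ μ A.1) {M : Marking X ι} {N : Marking X κ}
    (f : marked Γ ℤ μ M →ₗ[Crossed Γ ℤ μ] marked Γ ℤ μ N) {b : ℝ}
    (h : ∀ z, chiRing Γ ℤ μ A • z = z → l1Norm (f z : κ → Crossed Γ ℤ μ) ≤
      b * l1Norm (z : ι → Crossed Γ ℤ μ)) (z : marked Γ ℤ μ M) :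
    l1Norm (f z : κ → Crossed Γ ℤ μ) ≤ b * l1Norm (z : ι → Crossed Γ ℤ μ) := by
  have hz : f z = ∑ k, Q.into ℤ k • f (Q.back ℤ k • z) := by
    simp only [map_smul, ← mul_smul]
    rw [← Finset.sum_smul, Q.sum_into_mul_back, one_smul]
  rw [hz, Submodule.coe_sum, ← Q.sum_l1Norm_back_smul (z : ι → Crossed Γ ℤ μ), Finset.mul_sum]
  refine (l1Norm_sum_le _ _).trans (Finset.sum_le_sum fun k _ => ?_)
  refine (Q.l1Norm_into_smul_le k _).trans (h _ ?_)
  rw [← mul_smul, Q.chiRing_mul_back]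

end OpNorm

/-! ### Transport of the logarithmic norm -/

theorem dim_nonneg {X : Type*} [MeasurableSpace X] (μ : Measure X) {ι : Type} [Fintype ι]
    (A : Marking X ι) : 0 ≤ dim μ A :=
  Finset.sum_nonneg fun _ _ => measureReal_nonneg

theorem markedRank_nonneg {X : Type*} [MeasurableSpace X] {Γ : Type*} [Group Γ] [MulAction Γ X]
    [MeasurableConstSMul Γ X] {μ : Measure X} [SMulInvariantMeasure Γ X μ] {ι κ : Type}
    [Fintype ι] [Fintype κ] {A : Marking X ι} {B : Marking X κ}
    (f : marked Γ ℤ μ A →ₗ[Crossed Γ ℤ μ] marked Γ ℤ μ B) : 0 ≤ markedRank f :=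
  Real.sInf_nonneg fun _ ⟨_, _, _, h⟩ => h ▸ dim_nonneg μ _

theorem lognorm'_nonneg {X : Type*} [MeasurableSpace X] {Γ : Type*} [Group Γ] [MulAction Γ X]
    [MeasurableConstSMul Γ X] {μ : Measure X} [SMulInvariantMeasure Γ X μ] {ι κ : Type}
    [Fintype ι] [Fintype κ] {A : Marking X ι} {B : Marking X κ}
    (f : marked Γ ℤ μ A →ₗ[Crossed Γ ℤ μ] marked Γ ℤ μ B) : 0 ≤ lognorm' f :=
  le_min (mul_nonneg (dim_nonneg μ A) Real.posLog_nonneg)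
    (mul_nonneg (markedRank_nonneg f) Real.posLog_nonneg)

instance {X : Type*} [MeasurableSpace X] {ι : Type} (A : Marking X ι) :
    Nonempty (MarkedDecomposition A) :=
  ⟨⟨1, fun _ => A, fun _ k l h => (h (Subsingleton.elim k l)).elim, fun _ => Set.iUnion_const _⟩⟩

namespace BoundedOE

variable {Γ Λ : Type*} [Group Γ] [Group Λ] {X Y : Type*} [MeasurableSpace X]
  [MeasurableSpace Y] [StandardBorelSpace X] [StandardBorelSpace Y]
  [MulAction Γ X] [MulAction Λ Y] [MeasurableConstSMul Γ X] [MeasurableConstSMul Λ Y]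
  {μ : Measure X} {ν : Measure Y} [IsFiniteMeasure μ] [IsFiniteMeasure ν]
  [SMulInvariantMeasure Γ X μ] [SMulInvariantMeasure Λ Y ν]
  {c : ℝ} (T : BoundedOE Γ Λ μ ν c) (Q : TranslatePartition Γ μ T.dom.1) {m₁ m₂ : ℕ}
  {A : Marking X (Fin m₁)} {B : Marking X (Fin m₂)}

/-- The operator norms of corresponding homomorphisms agree: both norms are detected on the parts
over the two sides of the orbit equivalence, where transport scales `ℓ¹`-norms by the same
factor. -/
theorem opNorm_eq (f : marked Γ ℤ μ A →ₗ[Crossed Γ ℤ μ] marked Γ ℤ μ B)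
    (f' : marked Λ ℤ ν (T.pushMarking Q A) →ₗ[Crossed Λ ℤ ν] marked Λ ℤ ν (T.pushMarking Q B))
    (h : ∀ z, f' (T.pushModule Q A z) = T.pushModule Q B (f z)) : opNorm f' = opNorm f := by
  have hc : 0 < c⁻¹ := inv_pos.2 T.pos
  obtain ⟨Q'⟩ := Cofinite.nonempty_translatePartition T.cofinite_right
  have key : ∀ b : ℝ, ∀ z, chiRing Γ ℤ μ T.dom • z = z →
      (l1Norm (f' (T.pushModule Q A z) : Fin (m₂ * Q.num) → Crossed Λ ℤ ν) ≤
        b * l1Norm (T.pushModule Q A z : Fin (m₁ * Q.num) → Crossed Λ ℤ ν) ↔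
      l1Norm (f z : Fin m₂ → Crossed Γ ℤ μ) ≤ b * l1Norm (z : Fin m₁ → Crossed Γ ℤ μ)) := by
    intro b z hz
    have hfz : chiRing Γ ℤ μ T.dom • f z = f z := by rw [← f.map_smul, hz]
    rw [h, T.l1Norm_pushModule Q z hz, T.l1Norm_pushModule Q (f z) hfz, mul_left_comm,
      mul_le_mul_iff_right₀ hc]
  -- The two sets of admissible bounds coincide, so the infima agree even if there are none.
  unfold opNorm
  congr 1
  ext b
  refine and_congr_right fun _ => ⟨fun hb => ?_, fun hb => ?_⟩
  · exact bound_of_bound_on_corner Q f fun z hz => (key b z hz).1 (hb _)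
  · refine bound_of_bound_on_corner (A := T.symm.dom) Q' f' fun z' hz' => ?_
    obtain ⟨z, hz, rfl⟩ := T.exists_pushModule_eq Q A z' hz'
    exact (key b z hz).2 (hb z)

theorem pushModule_inclusion {A' : Marking X (Fin m₁)} (hA : A' ≤ A) (z : marked Γ ℤ μ A') :
    T.pushModule Q A (Submodule.inclusion (marked_mono hA) z) =
      Submodule.inclusion (marked_mono (T.pushMarking_mono Q hA)) (T.pushModule Q A' z) := rfl

theorem pushModule_mem {A' : Marking X (Fin m₁)} (hA : A' ≤ A) (z : marked Γ ℤ μ A)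
    (hz : (z : Fin m₁ → Crossed Γ ℤ μ) ∈ marked Γ ℤ μ A') :
    (T.pushModule Q A z : Fin (m₁ * Q.num) → Crossed Λ ℤ ν) ∈
      marked Λ ℤ ν (T.pushMarking Q A') := by
  have h1 : z = Submodule.inclusion (marked_mono hA) ⟨z, hz⟩ := rfl
  rw [h1, T.pushModule_inclusion Q hA, Submodule.coe_inclusion]
  exact Subtype.property _

theorem markedRank_le (f : marked Γ ℤ μ A →ₗ[Crossed Γ ℤ μ] marked Γ ℤ μ B)
    (f' : marked Λ ℤ ν (T.pushMarking Q A) →ₗ[Crossed Λ ℤ ν] marked Λ ℤ ν (T.pushMarking Q B))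
    (h : ∀ z, f' (T.pushModule Q A z) = T.pushModule Q B (f z)) :
    markedRank f' ≤ c⁻¹ * markedRank f := by
  rw [le_inv_mul_iff₀ T.pos]
  refine le_csInf ⟨_, B, le_rfl, fun z => (f z).2, rfl⟩ ?_
  rintro t ⟨B', hB', hmem, rfl⟩
  rw [← le_inv_mul_iff₀ T.pos, ← T.dim_pushMarking Q]
  refine csInf_le ⟨0, ?_⟩ ⟨T.pushMarking Q B', T.pushMarking_mono Q hB', fun z' => ?_, rfl⟩
  · rintro _ ⟨_, _, _, rfl⟩
    exact dim_nonneg ν _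
  · rw [T.eq_sum_pushModule Q A z', map_sum, Submodule.coe_sum]
    refine Submodule.sum_mem _ fun j _ => ?_
    rw [f'.map_smul, h, Submodule.coe_smul]
    exact Submodule.smul_mem _ _ (T.pushModule_mem Q hB' _ (hmem _))

theorem lognorm'_le (f : marked Γ ℤ μ A →ₗ[Crossed Γ ℤ μ] marked Γ ℤ μ B)
    (f' : marked Λ ℤ ν (T.pushMarking Q A) →ₗ[Crossed Λ ℤ ν] marked Λ ℤ ν (T.pushMarking Q B))
    (h : ∀ z, f' (T.pushModule Q A z) = T.pushModule Q B (f z)) :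
    lognorm' f' ≤ c⁻¹ * lognorm' f := by
  rw [lognorm', lognorm', T.opNorm_eq Q f f' h, T.dim_pushMarking Q,
    mul_min_of_nonneg _ _ (inv_pos.2 T.pos).le, mul_assoc, ← mul_assoc _ (markedRank f)]
  exact min_le_min le_rfl
    (mul_le_mul_of_nonneg_right (T.markedRank_le Q f f' h) Real.posLog_nonneg)

/-- The transport of a marked decomposition. -/
def pushDecomposition (P : MarkedDecomposition A) :
    MarkedDecomposition (T.pushMarking Q A) where
  num := P.num
  part k := T.pushMarking Q (P.part k)
  disjoint j k l hkl := by
    refine Set.disjoint_left.2 fun y hy hy' => ?_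
    exact Set.disjoint_left.1 (P.disjoint _ hkl) hy.2.1 hy'.2.1
  union j := by
    refine Set.Subset.antisymm (Set.iUnion_subset fun k => T.pushMarking_mono Q (P.le k) j) ?_
    intro y hy
    have h1 := hy.2.1
    rw [← P.union] at h1
    obtain ⟨k, hk⟩ := Set.mem_iUnion.1 h1
    exact Set.mem_iUnion.2 ⟨k, hy.1, hk, hy.2.2⟩

theorem lognorm_le (f : marked Γ ℤ μ A →ₗ[Crossed Γ ℤ μ] marked Γ ℤ μ B)
    (f' : marked Λ ℤ ν (T.pushMarking Q A) →ₗ[Crossed Λ ℤ ν] marked Λ ℤ ν (T.pushMarking Q B))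
    (h : ∀ z, f' (T.pushModule Q A z) = T.pushModule Q B (f z)) :
    lognorm f' ≤ c⁻¹ * lognorm f := by
  rw [le_inv_mul_iff₀ T.pos]
  refine le_ciInf fun P => ?_
  rw [← le_inv_mul_iff₀ T.pos, Finset.mul_sum]
  refine (ciInf_le ⟨0, ?_⟩ (T.pushDecomposition Q P)).trans
    (Finset.sum_le_sum fun k _ => T.lognorm'_le Q _ _ fun z => ?_)
  · rintro _ ⟨P', rfl⟩
    exact Finset.sum_nonneg fun k _ => lognorm'_nonneg _
  · exact h (Submodule.inclusion (marked_mono (P.le k)) z)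

end BoundedOE

/-! ### Transport of marked projective complexes -/

namespace BoundedOE

variable {Γ Λ : Type*} [Group Γ] [Group Λ] {X Y : Type*} [MeasurableSpace X]
  [MeasurableSpace Y] [StandardBorelSpace X] [StandardBorelSpace Y]
  [MulAction Γ X] [MulAction Λ Y] [MeasurableConstSMul Γ X] [MeasurableConstSMul Λ Y]
  {μ : Measure X} {ν : Measure Y} [SMulInvariantMeasure Γ X μ] [SMulInvariantMeasure Λ Y ν]
  {c : ℝ} (T : BoundedOE Γ Λ μ ν c) {Z : Type*} [CommRing Z]
  (Q : TranslatePartition Γ μ T.dom.1) (Q' : TranslatePartition Λ ν T.symm.dom.1)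

/-- The transport of a marked projective complex. -/
def pushComplex (D : MarkedComplex Γ Z μ) : MarkedComplex Λ Z ν where
  rank r := D.rank r * Q.num
  A r := T.pushMarking Q (D.A r)
  d r := T.pushHom Q (D.d r) (T.pushModule Q (D.A r))
  η := T.pushHom Q D.η T.push
  d_comp_d r z' := by
    have h : T.pushHom Q (D.d r) (T.pushModule Q (D.A r)) ∘ₗ
        T.pushHom Q (D.d (r + 1)) (T.pushModule Q (D.A (r + 1))) = 0 :=
      T.hom_ext_pushModule Q fun z => by
        rw [LinearMap.comp_apply, T.pushHom_pushModule Q _ (T.compatible_pushModule Q _),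
          T.pushHom_pushModule Q _ (T.compatible_pushModule Q _), D.d_comp_d, map_zero,
          LinearMap.zero_apply]
    exact LinearMap.congr_fun h z'
  η_comp_d z' := by
    have h : T.pushHom Q D.η T.push ∘ₗ
        T.pushHom Q (D.d 0) (T.pushModule Q (D.A 0)) = 0 :=
      T.hom_ext_pushModule Q fun z => by
        rw [LinearMap.comp_apply, T.pushHom_pushModule Q _ (T.compatible_pushModule Q _),
          T.pushHom_pushModule Q _ T.compatible_push, D.η_comp_d, map_zero, LinearMap.zero_apply]
    exact LinearMap.congr_fun h z'
  surjective b := by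
    obtain ⟨Q'⟩ := Cofinite.nonempty_translatePartition T.cofinite_right
    change TranslatePartition Λ ν T.symm.dom.1 at Q'
    have h1 : ∀ k, ∃ z', T.pushHom Q D.η T.push z' =
        Q'.back Z k • b := by
      intro k
      obtain ⟨z, hz⟩ := D.surjective
        (T.symm.push (Q'.back Z k • b))
      refine ⟨T.pushModule Q _ z, ?_⟩
      rw [T.pushHom_pushModule Q _ T.compatible_push, hz]
      refine (T.symm.push_symm_push _).trans ?_
      rw [← chiRing_smul (Γ := Λ), ← mul_smul]
      exact congrArg (· • b) (Q'.chiRing_mul_back k)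
    choose z' hz' using h1
    refine ⟨∑ k, Q'.into Z k • z' k, ?_⟩
    simp only [map_sum, map_smul, hz', ← mul_smul]
    rw [← Finset.sum_smul, TranslatePartition.sum_into_mul_back, one_smul]

theorem pushComplex_d_pushModule (D : MarkedComplex Γ Z μ) (r : ℕ)
    (z : marked Γ Z μ (D.A (r + 1))) :
    (T.pushComplex Q D).d r (T.pushModule Q _ z) = T.pushModule Q _ (D.d r z) :=
  T.pushHom_pushModule Q _ (T.compatible_pushModule Q _) z

theorem pushComplex_η_pushModule (D : MarkedComplex Γ Z μ) (z : marked Γ Z μ (D.A 0)) :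
    (T.pushComplex Q D).η (T.pushModule Q _ z) = T.push (D.η z) :=
  T.pushHom_pushModule Q _ T.compatible_push z

/-! ### Coinduction from `R_α`-modules to `R_β`-modules -/

section Coinduced

variable {M N : Type*} [AddCommGroup M] [Module (Crossed Γ Z μ) M] [AddCommGroup N]
  [Module (Crossed Γ Z μ) N]

variable (Z M) in
/-- The coinduced module `Hom_S(χ_B R_β, χ_A M)`, where `S` is the common corner ring
`χ_A R_α χ_A ≅ χ_B R_β χ_B`. A homomorphism defined on `χ_B R_β` is extended to `R_β` by
precomposition with the multiplication by `χ_B`. -/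
def Coinduced : AddSubgroup (Crossed Λ Z ν →+ M) where
  carrier := {h | (∀ s x, h (s * chiRing Λ Z ν T.symm.dom * x) = T.symm.ringPush s • h x) ∧
    ∀ x, h (chiRing Λ Z ν T.symm.dom * x) = h x}
  add_mem' := by
    rintro h h' ⟨h1, h2⟩ ⟨h1', h2'⟩
    refine ⟨fun s x => ?_, fun x => ?_⟩
    · rw [AddMonoidHom.add_apply, AddMonoidHom.add_apply, h1, h1', smul_add]
    · rw [AddMonoidHom.add_apply, AddMonoidHom.add_apply, h2, h2']
  zero_mem' := ⟨fun s x => by simp, fun x => by simp⟩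
  neg_mem' := by
    rintro h ⟨h1, h2⟩
    refine ⟨fun s x => ?_, fun x => ?_⟩
    · rw [AddMonoidHom.neg_apply, AddMonoidHom.neg_apply, h1, smul_neg]
    · rw [AddMonoidHom.neg_apply, AddMonoidHom.neg_apply, h2]

namespace Coinduced

variable {T}

theorem map_mul (h : T.Coinduced Z M) (s x : Crossed Λ Z ν) :
    (h : Crossed Λ Z ν →+ M) (s * chiRing Λ Z ν T.symm.dom * x) =
      T.symm.ringPush s • (h : Crossed Λ Z ν →+ M) x := h.2.1 s x

theorem map_dom_mul (h : T.Coinduced Z M) (x : Crossed Λ Z ν) :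
    (h : Crossed Λ Z ν →+ M) (chiRing Λ Z ν T.symm.dom * x) =
      (h : Crossed Λ Z ν →+ M) x := h.2.2 x

/-- `R_β` acts on coinduced modules through right multiplication in the argument. -/
instance : Module (Crossed Λ Z ν) (T.Coinduced Z M) where
  smul r h := ⟨(h : Crossed Λ Z ν →+ M).comp (AddMonoidHom.mulRight r), fun s x => by
      simp only [AddMonoidHom.comp_apply, AddMonoidHom.mulRight_apply]
      rw [mul_assoc _ x, map_mul], fun x => by
      simp only [AddMonoidHom.comp_apply, AddMonoidHom.mulRight_apply]
      rw [mul_assoc, map_dom_mul]⟩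
  one_smul h := Subtype.ext (AddMonoidHom.ext fun x =>
    congrArg (h : Crossed Λ Z ν →+ M) (mul_one x))
  mul_smul r s h := Subtype.ext (AddMonoidHom.ext fun x =>
    congrArg (h : Crossed Λ Z ν →+ M) (mul_assoc x r s).symm)
  smul_zero r := rfl
  smul_add r h h' := rfl
  add_smul r s h := Subtype.ext (AddMonoidHom.ext fun x =>
    (congrArg (h : Crossed Λ Z ν →+ M) (mul_add x r s)).trans (map_add _ _ _))
  zero_smul h := Subtype.ext (AddMonoidHom.ext fun x =>
    (congrArg (h : Crossed Λ Z ν →+ M) (mul_zero x)).trans (map_zero _))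

variable (T) in
/-- Functoriality of coinduction. -/
def map (f : M →ₗ[Crossed Γ Z μ] N) : T.Coinduced Z M →ₗ[Crossed Λ Z ν] T.Coinduced Z N where
  toFun h := ⟨f.toAddMonoidHom.comp (h : Crossed Λ Z ν →+ M), fun s x => by
      simp only [AddMonoidHom.comp_apply, map_mul]
      exact f.map_smul _ _, fun x => by
      simp only [AddMonoidHom.comp_apply, map_dom_mul]⟩
  map_add' h h' := Subtype.ext (AddMonoidHom.ext fun x => f.map_add _ _)
  map_smul' r h := rfl

theorem map_apply (f : M →ₗ[Crossed Γ Z μ] N) (h : T.Coinduced Z M) (x : Crossed Λ Z ν) :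
    (map T f h : Crossed Λ Z ν →+ N) x = f ((h : Crossed Λ Z ν →+ M) x) := rfl

theorem apply_eq_sum (h : T.Coinduced Z M) (x : Crossed Λ Z ν) :
    (h : Crossed Λ Z ν →+ M) x = ∑ l, T.symm.ringPush (x * Q'.into Z l) •
      (h : Crossed Λ Z ν →+ M) (Q'.back Z l) := by
  have h1 : x = ∑ l, x * Q'.into Z l * chiRing Λ Z ν T.symm.dom * Q'.back Z l := by
    simp only [mul_assoc, TranslatePartition.chiRing_mul_back]
    rw [← Finset.mul_sum, TranslatePartition.sum_into_mul_back, mul_one]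
  conv_lhs => rw [h1, map_sum]
  exact Finset.sum_congr rfl fun l _ => map_mul h _ _

/-- Coinduction is exact: an element of a coinduced module is determined by its values at the
finitely many `g_l⁻¹ χ_{P l}`, and it suffices to lift these. -/
theorem exists_map_eq (f : M →ₗ[Crossed Γ Z μ] N) (h : T.Coinduced Z N)
    (hf : ∀ x, (h : Crossed Λ Z ν →+ N) x ∈ LinearMap.range f) :
    ∃ k : T.Coinduced Z M, map T f k = h := by
  obtain ⟨Q'⟩ := Cofinite.nonempty_translatePartition T.cofinite_right
  change TranslatePartition Λ ν T.symm.dom.1 at Q'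
  choose m hm using fun l => hf (Q'.back Z l)
  let k : Crossed Λ Z ν →+ M := ∑ l, ((AddMonoidHom.flip
    (smulAddHom (Crossed Γ Z μ) M) (m l)).comp T.symm.ringPush).comp
      (AddMonoidHom.mulRight (Q'.into Z l))
  have hk : ∀ x, k x = ∑ l, T.symm.ringPush (x * Q'.into Z l) • m l := fun x => by
    simp only [k, AddMonoidHom.finsetSum_apply]
    rfl
  refine ⟨⟨k, fun s x => ?_, fun x => ?_⟩, Subtype.ext (AddMonoidHom.ext fun x => ?_)⟩
  · simp only [hk, Finset.smul_sum, ← mul_smul]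
    refine Finset.sum_congr rfl fun l _ => ?_
    rw [mul_assoc _ x, ringPush_mul_dom]
  · simp only [hk]
    refine Finset.sum_congr rfl fun l _ => ?_
    rw [mul_assoc _ x, ringPush_dom_mul]
  · rw [map_apply, apply_eq_sum Q' h]
    change f (k x) = _
    simp only [hk, map_sum, map_smul, hm]

theorem dom_smul_apply (h : T.Coinduced Z M) (x : Crossed Λ Z ν) :
    chiRing Γ Z μ T.dom • (h : Crossed Λ Z ν →+ M) x = (h : Crossed Λ Z ν →+ M) x := by
  have h1 := map_mul h 1 x
  rw [one_mul, map_dom_mul, ringPush_one] at h1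
  exact h1.symm

/-- The homomorphism from the coinduced module that corresponds to a compatible map. -/
def eval {N' : Type*} [AddCommGroup N'] [Module (Crossed Λ Z ν) N'] (s : M →+ N')
    (hs : T.Compatible Z s) : T.Coinduced Z M →ₗ[Crossed Λ Z ν] N' where
  toFun h := ∑ l, Q'.into Z l • s ((h : Crossed Λ Z ν →+ M) (Q'.back Z l))
  map_add' h h' := by
    rw [← Finset.sum_add_distrib]
    refine Finset.sum_congr rfl fun l _ => ?_
    rw [← smul_add, ← map_add]
    rfl
  map_smul' r h := by
    have h0 : ∀ t x, s (T.symm.ringPush t • (h : Crossed Λ Z ν →+ M) x) =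
        (chiRing Λ Z ν T.symm.dom * t * chiRing Λ Z ν T.symm.dom) •
          s ((h : Crossed Λ Z ν →+ M) x) := fun t x => by
      have h1 := hs (T.symm.ringPush t) ((h : Crossed Λ Z ν →+ M) x)
      rw [dom_smul_apply] at h1
      rw [h1]
      exact congrArg (· • _) (T.symm.ringPush_symm_ringPush t)
    have h2 : ∀ x, chiRing Λ Z ν T.symm.dom • s ((h : Crossed Λ Z ν →+ M) x) =
        s ((h : Crossed Λ Z ν →+ M) x) := fun x => by
      have h1 := hs 1 ((h : Crossed Λ Z ν →+ M) x)
      rwa [dom_smul_apply, one_smul, ringPush_one, eq_comm] at h1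
    have h3 : ∀ l, Q'.into Z l • s ((h : Crossed Λ Z ν →+ M) (Q'.back Z l * r)) =
        ∑ l', (Q'.into Z l * Q'.back Z l * (r * Q'.into Z l')) •
          s ((h : Crossed Λ Z ν →+ M) (Q'.back Z l')) := fun l => by
      rw [apply_eq_sum Q' h, map_sum, Finset.smul_sum]
      refine Finset.sum_congr rfl fun l' _ => ?_
      rw [h0, mul_smul _ (chiRing Λ Z ν T.symm.dom), h2, ← mul_smul, mul_assoc (Q'.back Z l),
        ← mul_assoc (chiRing Λ Z ν T.symm.dom), TranslatePartition.chiRing_mul_back,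
        mul_assoc (Q'.into Z l)]
    change ∑ l, Q'.into Z l • s ((h : Crossed Λ Z ν →+ M) (Q'.back Z l * r)) = _
    simp only [h3]
    rw [Finset.sum_comm, RingHom.id_apply, Finset.smul_sum]
    refine Finset.sum_congr rfl fun l' _ => ?_
    rw [← Finset.sum_smul, ← Finset.sum_mul, TranslatePartition.sum_into_mul_back, one_mul,
      mul_smul]

theorem eval_apply {N' : Type*} [AddCommGroup N'] [Module (Crossed Λ Z ν) N'] (s : M →+ N')
    (hs : T.Compatible Z s) (h : T.Coinduced Z M) : eval Q' s hs h =
      ∑ l, Q'.into Z l • s ((h : Crossed Λ Z ν →+ M) (Q'.back Z l)) := rfl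

theorem eval_map {M' N' : Type*} [AddCommGroup N'] [Module (Crossed Λ Z ν) N']
    [AddCommGroup M'] [Module (Crossed Λ Z ν) M'] {s : M →+ M'} (hs : T.Compatible Z s)
    {t : N →+ N'} (ht : T.Compatible Z t) (f : M →ₗ[Crossed Γ Z μ] N)
    (f' : M' →ₗ[Crossed Λ Z ν] N') (h : ∀ z, f' (s z) = t (f z)) (k : T.Coinduced Z M) :
    f' (eval Q' s hs k) = eval Q' t ht (map T f k) := by
  simp only [eval_apply, map_sum, map_smul, h, map_apply]

variable (T) in
/-- A bounded function `b` on `Y` defines the element `x ↦ (x · b) ∘ φ` of the module coinduced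
from `L^∞(X)`. -/
def ofFunction : LInfty Z ν →ₗ[Crossed Λ Z ν] T.Coinduced Z (LInfty Z μ) where
  toFun b := ⟨T.symm.push.comp
    (AddMonoidHom.flip (smulAddHom (Crossed Λ Z ν) (LInfty Z ν)) b), fun s x => by
      change T.symm.push ((s * _ * x) • b) = T.symm.ringPush s • T.symm.push (x • b)
      rw [mul_smul, push_smul_dom], fun x => by
      change T.symm.push ((_ * x) • b) = T.symm.push (x • b)
      rw [mul_smul, chiRing_smul, push_chi_dom_mul]⟩
  map_add' b b' := Subtype.ext (AddMonoidHom.ext fun x => by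
    change T.symm.push (x • (b + b')) = T.symm.push (x • b) + T.symm.push (x • b')
    rw [smul_add, map_add])
  map_smul' r b := Subtype.ext (AddMonoidHom.ext fun x =>
    congrArg T.symm.push (mul_smul x r b).symm)

theorem ofFunction_apply (b : LInfty Z ν) (x : Crossed Λ Z ν) :
    (ofFunction T b : Crossed Λ Z ν →+ LInfty Z μ) x = T.symm.push (x • b) := rfl

theorem eval_ofFunction (b : LInfty Z ν) :
    eval Q' T.push T.compatible_push (ofFunction T b) = b := by
  rw [eval_apply]
  have h : ∀ l, T.push ((ofFunction T b : Crossed Λ Z ν →+ LInfty Z μ) (Q'.back Z l)) =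
      Q'.back Z l • b := fun l => by
    rw [ofFunction_apply]
    refine (T.symm.push_symm_push _).trans ?_
    rw [← chiRing_smul (Γ := Λ), ← mul_smul, TranslatePartition.chiRing_mul_back]
  simp only [h, ← mul_smul]
  rw [← Finset.sum_smul, TranslatePartition.sum_into_mul_back, one_smul]

end Coinduced

end Coinduced

end BoundedOE

/-! ### Lifting chain maps along a change of rings -/

section Lifting

variable {S R : Type*} [Ring S] [Ring R] (σ : S →+* R)

theorem exists_semilinear_lift {P M N : Type*} [AddCommGroup P] [Module S P]
    [Module.Projective S P] [AddCommGroup M] [Module R M] [AddCommGroup N] [Module R N]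
    (f : M →ₗ[R] N) (g : P →ₛₗ[σ] N) (h : ∀ x, g x ∈ LinearMap.range f) :
    ∃ k : P →ₛₗ[σ] M, ∀ x, f (k x) = g x := by
  let := Module.compHom M σ
  let := Module.compHom (LinearMap.range f) σ
  let f' : M →ₗ[S] LinearMap.range f :=
    { toFun := fun m => ⟨f m, m, rfl⟩
      map_add' := fun m m' => Subtype.ext (f.map_add m m')
      map_smul' := fun s m => Subtype.ext (f.map_smul (σ s) m) }
  let g' : P →ₗ[S] LinearMap.range f :=
    { toFun := fun x => ⟨g x, h x⟩
      map_add' := fun x y => Subtype.ext (g.map_add x y)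
      map_smul' := fun s x => Subtype.ext (g.map_smulₛₗ s x) }
  have hf' : Function.Surjective f' := by
    rintro ⟨_, m, rfl⟩
    exact ⟨m, rfl⟩
  obtain ⟨k, hk⟩ := Module.projective_lifting_property f' g' hf'
  exact ⟨{ toFun := k, map_add' := k.map_add, map_smul' := fun s x => k.map_smul s x },
    fun x => congrArg Subtype.val (LinearMap.congr_fun hk x)⟩

/-- A complex of projective `S`-modules maps to every exact complex of `R`-modules. -/
theorem exists_chain_lift {P K : ℕ → Type*} {N : Type*} [∀ r, AddCommGroup (P r)]
    [∀ r, Module S (P r)] [∀ r, Module.Projective S (P r)] [∀ r, AddCommGroup (K r)]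
    [∀ r, Module R (K r)] [AddCommGroup N] [Module R N]
    (d : ∀ r, P (r + 1) →ₗ[S] P r) (δ : ∀ r, K (r + 1) →ₗ[R] K r) (ε : K 0 →ₗ[R] N)
    (g : P 0 →ₛₗ[σ] N) (hd : ∀ r x, d r (d (r + 1) x) = 0) (hg : ∀ x, g x ∈ LinearMap.range ε)
    (hgd : ∀ x, g (d 0 x) = 0) (hε : ∀ k, ε k = 0 → k ∈ LinearMap.range (δ 0))
    (hδ : ∀ r k, δ r k = 0 → k ∈ LinearMap.range (δ (r + 1))) :
    ∃ G : ∀ r, P r →ₛₗ[σ] K r, (∀ x, ε (G 0 x) = g x) ∧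
      ∀ r x, δ r (G (r + 1) x) = G r (d r x) := by
  obtain ⟨G₀, hG₀⟩ := exists_semilinear_lift σ ε g hg
  -- The lift in degree `r` is constructed along with the fact that it maps boundaries to
  -- boundaries, which is what the next step requires.
  have step : ∀ r (G : {G : P r →ₛₗ[σ] K r // ∀ x, G (d r x) ∈ LinearMap.range (δ r)}),
      ∃ G' : {G' : P (r + 1) →ₛₗ[σ] K (r + 1) //
        ∀ x, G' (d (r + 1) x) ∈ LinearMap.range (δ (r + 1))},
      ∀ x, δ r (G'.1 x) = G.1 (d r x) := by
    intro r G
    obtain ⟨G', hG'⟩ := exists_semilinear_lift σ (δ r) (G.1.comp (d r)) G.2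
    refine ⟨⟨G', fun x => hδ r _ ?_⟩, hG'⟩
    rw [hG', LinearMap.comp_apply, hd, map_zero]
  choose next hnext using step
  let H : ∀ r, {G : P r →ₛₗ[σ] K r // ∀ x, G (d r x) ∈ LinearMap.range (δ r)} := fun r =>
    Nat.rec ⟨G₀, fun x => hε _ (by rw [hG₀, hgd])⟩ (fun r G => next r G) r
  exact ⟨fun r => (H r).1, hG₀, fun r x => hnext r (H r) x⟩

end Lifting

/-! ### The resolution `L^∞(X) ⊗ C` over the crossed product -/

section Tensor

variable {X : Type*} [MeasurableSpace X] {Γ : Type*} [Group Γ] [MulAction Γ X]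
  [MeasurableConstSMul Γ X] {Z : Type*} [CommRing Z] (μ : Measure X) [SMulInvariantMeasure Γ X μ]

instance : Algebra Z (LInfty Z μ) := (LInfty.const Z μ).toAlgebra

theorem algebraMap_LInfty (z : Z) : algebraMap Z (LInfty Z μ) z = LInfty.const Z μ z := rfl

instance : Module.IsTorsionFree Z (LInfty Z μ) where
  isSMulRegular z hz a b hab := by
    obtain ⟨f, rfl⟩ := LInfty.mk_surjective Z μ a
    obtain ⟨g, rfl⟩ := LInfty.mk_surjective Z μ b
    have h1 : LInfty.mk Z μ (SimpleFunc.const X z * f) =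
        LInfty.mk Z μ (SimpleFunc.const X z * g) := by
      rw [map_mul, map_mul]
      simp only [Algebra.smul_def] at hab
      exact hab
    rw [LInfty.mk_eq_mk] at h1 ⊢
    filter_upwards [h1] with x hx
    exact hz.1 hx

theorem groupRingToCrossed_smul_const (s : MonoidAlgebra Z Γ) (z : Z) :
    groupRingToCrossed Γ Z μ s • LInfty.const Z μ z =
      LInfty.const Z μ (augmentation Z Γ s • z) := by
  induction s using MonoidAlgebra.induction_linear with
  | zero => simp
  | add s t hs ht => rw [map_add, map_add, add_smul, add_smul, hs, ht, map_add]
  | single γ w =>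
    rw [groupRingToCrossed_single, single_smul, smul_const, ← map_mul]
    congr 1
    simp [augmentation]

variable (P : Resolution Z Γ)

instance (r : ℕ) : Module Z (P.C r) := Module.compHom (P.C r) (algebraMap Z (MonoidAlgebra Z Γ))

theorem coeff_smul_def {r : ℕ} (z : Z) (x : P.C r) :
    z • x = algebraMap Z (MonoidAlgebra Z Γ) z • x := rfl

/-- The module `L^∞(X) ⊗_Z C_r`. -/
abbrev ScalarExt (r : ℕ) : Type _ := LInfty Z μ ⊗[Z] P.C r

/-- The diagonal action of a group element on `L^∞(X) ⊗_Z C_r`. -/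
def extSMul (r : ℕ) (γ : Γ) : ScalarExt μ P r →ₗ[Z] ScalarExt μ P r :=
  TensorProduct.map
    { toFun := fun a => γ • a
      map_add' := smul_add γ
      map_smul' := fun z a => by
        rw [Algebra.smul_def, algebraMap_LInfty, smul_mul', smul_const]
        rfl }
    { toFun := fun x => MonoidAlgebra.single γ (1 : Z) • x
      map_add' := smul_add _
      map_smul' := fun z x => by
        rw [RingHom.id_apply, coeff_smul_def, coeff_smul_def, ← mul_smul, ← mul_smul,
          Algebra.commutes] }

theorem extSMul_tmul (r : ℕ) (γ : Γ) (a : LInfty Z μ) (x : P.C r) :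
    extSMul μ P r γ (a ⊗ₜ x) = (γ • a) ⊗ₜ (MonoidAlgebra.single γ (1 : Z) • x) := rfl

/-- The diagonal action of the group on `L^∞(X) ⊗_Z C_r`. -/
def extHom (r : ℕ) : Γ →* AddMonoid.End (ScalarExt μ P r) where
  toFun γ := (extSMul μ P r γ).toAddMonoidHom
  map_one' := by
    have h : extSMul μ P r 1 = LinearMap.id := TensorProduct.ext' fun a x => by
      rw [extSMul_tmul, one_smul, ← MonoidAlgebra.one_def, one_smul, LinearMap.id_apply]
    rw [h]
    rfl
  map_mul' γ δ := by
    have h : extSMul μ P r (γ * δ) = extSMul μ P r γ ∘ₗ extSMul μ P r δ :=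
      TensorProduct.ext' fun a x => by
        rw [LinearMap.comp_apply, extSMul_tmul, extSMul_tmul, extSMul_tmul, mul_smul γ δ a,
          ← mul_smul (MonoidAlgebra.single γ (1 : Z)), MonoidAlgebra.single_mul_single, one_mul]
    rw [h]
    rfl

/-- The crossed product acts on `L^∞(X) ⊗_Z C_r`, functions by multiplication in the first factor
and group elements diagonally. This is the scalar extension of `C_r` from the group ring. -/
def crossedToEndExt (r : ℕ) : Crossed Γ Z μ →+* AddMonoid.End (ScalarExt μ P r) :=
  SkewMonoidAlgebra.liftNCRingHom (Module.toAddMonoidEnd (LInfty Z μ) (ScalarExt μ P r))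
    (extHom μ P r) (by
      intro a γ
      refine AddMonoidHom.ext fun k => ?_
      change (γ • a) • extSMul μ P r γ k = extSMul μ P r γ (a • k)
      induction k using TensorProduct.induction_on with
      | zero => simp
      | tmul b x => rw [extSMul_tmul, TensorProduct.smul_tmul', TensorProduct.smul_tmul',
          extSMul_tmul, smul_eq_mul, smul_eq_mul, smul_mul']
      | add k l hk hl => rw [map_add, smul_add, smul_add, map_add, hk, hl])

instance (r : ℕ) : Module (Crossed Γ Z μ) (ScalarExt μ P r) :=
  Module.compHom _ (crossedToEndExt μ P r)

theorem single_smul_tmul {r : ℕ} (γ : Γ) (a b : LInfty Z μ) (x : P.C r) :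
    (SkewMonoidAlgebra.single γ a : Crossed Γ Z μ) • (b ⊗ₜ x : ScalarExt μ P r) =
      (a * γ • b) ⊗ₜ (MonoidAlgebra.single γ (1 : Z) • x) :=
  DFunLike.congr_fun (SkewMonoidAlgebra.liftNC_single
    (Module.toAddMonoidEnd (LInfty Z μ) (ScalarExt μ P r) : LInfty Z μ →+ AddMonoid.End (ScalarExt μ P r))
    (extHom μ P r) γ a) (b ⊗ₜ x)

variable {P} in
/-- An additive map on `L^∞(X) ⊗_Z C_r` is linear over the crossed product if it is so on
generators. -/
def linearOfTmul {r : ℕ} {M : Type*} [AddCommGroup M] [Module (Crossed Γ Z μ) M]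
    (f : ScalarExt μ P r →+ M) (h : ∀ (γ : Γ) (a b : LInfty Z μ) (x : P.C r),
      f ((a * γ • b) ⊗ₜ (MonoidAlgebra.single γ (1 : Z) • x)) =
        (SkewMonoidAlgebra.single γ a : Crossed Γ Z μ) • f (b ⊗ₜ x)) :
    ScalarExt μ P r →ₗ[Crossed Γ Z μ] M where
  toFun := f
  map_add' := f.map_add
  map_smul' s k := by
    rw [RingHom.id_apply]
    induction s using SkewMonoidAlgebra.induction_on with
    | zero => rw [zero_smul, zero_smul, map_zero]
    | add s t hs ht => rw [add_smul, add_smul, map_add, hs, ht]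
    | single γ a =>
      induction k using TensorProduct.induction_on with
      | zero => rw [smul_zero, map_zero, smul_zero]
      | add k l hk hl => rw [smul_add, map_add, map_add, smul_add, hk, hl]
      | tmul b x => rw [single_smul_tmul, h]

/-- The boundary operators of a resolution are linear over the coefficient ring. -/
def coeffBoundary (r : ℕ) : P.C (r + 1) →ₗ[Z] P.C r where
  toFun := P.d r
  map_add' := map_add _
  map_smul' _ _ := (P.d r).map_smul _ _

/-- The augmentation of a resolution is linear over the coefficient ring. -/
def coeffAugmentation : P.C 0 →ₗ[Z] Z where
  toFun := P.ζ
  map_add' := map_add _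
  map_smul' z x := by
    rw [coeff_smul_def, P.ζ.map_smulₛₗ]
    congr 1
    simp [augmentation]

/-- The boundary operators of `L^∞(X) ⊗_Z C`. -/
def extBoundary (r : ℕ) : ScalarExt μ P (r + 1) →ₗ[Crossed Γ Z μ] ScalarExt μ P r :=
  linearOfTmul μ ((coeffBoundary P r).lTensor (LInfty Z μ)).toAddMonoidHom fun γ a b x => by
    change (a * γ • b) ⊗ₜ P.d r _ = (SkewMonoidAlgebra.single γ a : Crossed Γ Z μ) • (b ⊗ₜ P.d r x)
    rw [single_smul_tmul, map_smul]

theorem extBoundary_tmul (r : ℕ) (a : LInfty Z μ) (x : P.C (r + 1)) :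
    extBoundary μ P r (a ⊗ₜ x) = a ⊗ₜ P.d r x := rfl

theorem zeta_single_smul (γ : Γ) (x : P.C 0) :
    P.ζ (MonoidAlgebra.single γ (1 : Z) • x) = P.ζ x := by
  rw [P.ζ.map_smulₛₗ]
  simp [augmentation]

/-- The augmentation of `L^∞(X) ⊗_Z C`. -/
def extAugmentation : ScalarExt μ P 0 →ₗ[Crossed Γ Z μ] LInfty Z μ :=
  linearOfTmul μ ((TensorProduct.rid Z (LInfty Z μ)).toLinearMap ∘ₗ
    (coeffAugmentation P).lTensor (LInfty Z μ)).toAddMonoidHom fun γ a b x => by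
    change P.ζ _ • (a * γ • b) = (SkewMonoidAlgebra.single γ a : Crossed Γ Z μ) • (P.ζ x • b)
    rw [zeta_single_smul, single_smul, Algebra.smul_def, Algebra.smul_def, algebraMap_LInfty,
      smul_mul', smul_const, mul_left_comm]

theorem extAugmentation_tmul (a : LInfty Z μ) (x : P.C 0) :
    extAugmentation μ P (a ⊗ₜ x) = P.ζ x • a := rfl

section Exact

variable [IsDomain Z] [IsPrincipalIdealRing Z]

theorem extBoundary_exact (r : ℕ) (k : ScalarExt μ P (r + 1)) (h : extBoundary μ P r k = 0) :
    k ∈ LinearMap.range (extBoundary μ P (r + 1)) := by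
  have h1 : Function.Exact ((coeffBoundary P (r + 1)).lTensor (LInfty Z μ))
      ((coeffBoundary P r).lTensor (LInfty Z μ)) :=
    Module.Flat.lTensor_exact (LInfty Z μ) (P.exact_succ r)
  exact (h1 k).1 h

theorem extAugmentation_exact (k : ScalarExt μ P 0) (h : extAugmentation μ P k = 0) :
    k ∈ LinearMap.range (extBoundary μ P 0) := by
  have h1 : Function.Exact ((coeffBoundary P 0).lTensor (LInfty Z μ))
      ((coeffAugmentation P).lTensor (LInfty Z μ)) :=
    Module.Flat.lTensor_exact (LInfty Z μ) P.exact_zero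
  exact (h1 k).1 ((TensorProduct.rid Z (LInfty Z μ)).map_eq_zero_iff.1 h)

end Exact

theorem extAugmentation_surjective : Function.Surjective (extAugmentation μ P) := by
  intro a
  obtain ⟨x, hx⟩ := P.surjective 1
  exact ⟨a ⊗ₜ x, by rw [extAugmentation_tmul, hx, one_smul]⟩

variable {P} in
/-- The extension of a semilinear map on `C_r` to `L^∞(X) ⊗_Z C_r`. -/
def extLift {r : ℕ} {M : Type*} [AddCommGroup M] [Module (Crossed Γ Z μ) M]
    (f : P.C r →ₛₗ[groupRingToCrossed Γ Z μ] M) : ScalarExt μ P r →ₗ[Crossed Γ Z μ] M :=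
  linearOfTmul μ (TensorProduct.liftAddHom
    (((AddMonoidHom.compHom.flip f.toAddMonoidHom).comp
      (smulAddHom (Crossed Γ Z μ) M)).comp (SkewMonoidAlgebra.singleAddHom (1 : Γ)))
    fun z a x => by
      change (SkewMonoidAlgebra.single 1 (z • a) : Crossed Γ Z μ) • f x =
        (SkewMonoidAlgebra.single 1 a : Crossed Γ Z μ) • f (algebraMap Z (MonoidAlgebra Z Γ) z • x)
      have h : (algebraMap Z (MonoidAlgebra Z Γ) z) = MonoidAlgebra.single 1 z := rfl
      rw [h, f.map_smulₛₗ, groupRingToCrossed_single, ← mul_smul,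
        SkewMonoidAlgebra.single_mul_single, one_smul, one_mul, mul_comm, Algebra.smul_def]
      rfl) fun γ a b x => by
    change (SkewMonoidAlgebra.single 1 (a * γ • b) : Crossed Γ Z μ) • f _ =
      (SkewMonoidAlgebra.single γ a : Crossed Γ Z μ) •
        (SkewMonoidAlgebra.single 1 b : Crossed Γ Z μ) • f x
    rw [f.map_smulₛₗ, groupRingToCrossed_single, ← mul_smul, ← mul_smul, map_one,
      SkewMonoidAlgebra.single_mul_single, SkewMonoidAlgebra.single_mul_single, one_smul, mul_one,
      one_mul, mul_one]

theorem extLift_tmul {r : ℕ} {M : Type*} [AddCommGroup M] [Module (Crossed Γ Z μ) M]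
    (f : P.C r →ₛₗ[groupRingToCrossed Γ Z μ] M) (a : LInfty Z μ) (x : P.C r) :
    extLift μ f (a ⊗ₜ x) = (SkewMonoidAlgebra.single 1 a : Crossed Γ Z μ) • f x := rfl

end Tensor

/-! ### Transport of measured embeddings -/

namespace BoundedOE

section Aug

variable {Γ Λ : Type*} [Group Γ] [Group Λ] {X Y : Type*} [MeasurableSpace X]
  [MeasurableSpace Y] [StandardBorelSpace X] [StandardBorelSpace Y]
  [MulAction Γ X] [MulAction Λ Y] [MeasurableConstSMul Γ X] [MeasurableConstSMul Λ Y]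
  {μ : Measure X} {ν : Measure Y} [SMulInvariantMeasure Γ X μ] [SMulInvariantMeasure Λ Y ν]
  {c : ℝ} (T : BoundedOE Γ Λ μ ν c) {Z : Type*} [CommRing Z] [IsDomain Z]
  [IsPrincipalIdealRing Z] (Q : TranslatePartition Γ μ T.dom.1)

variable (Z) in
/-- The semilinear extension of the augmentation to the module coinduced from `L^∞(X)`. -/
def coinducedAugmentation (P : Resolution Z Λ) :
    P.C 0 →ₛₗ[groupRingToCrossed Λ Z ν] T.Coinduced Z (LInfty Z μ) where
  toFun x := Coinduced.ofFunction T (LInfty.const Z ν (P.ζ x))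
  map_add' x y := by simp only [map_add]
  map_smul' s x := by
    rw [← map_smul, groupRingToCrossed_smul_const, P.ζ.map_smulₛₗ]

/-- Transport preserves measured embeddings. The `R_α`-complex `L^∞(X) ⊗ C` maps to `D`, so the
exact complex coinduced from it maps to the transport of `D`; and every free resolution of `Z` over
`Z Λ` maps to this exact complex. -/
theorem pushComplex_mem_Aug (n : ℕ) (C : FreeResolution Z Γ) (E : FreeResolution Z Λ)
    {D : MarkedComplex Γ Z μ} (hD : D ∈ Aug μ n C) : T.pushComplex Q D ∈ Aug ν n E := by
  obtain ⟨φ⟩ := hD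
  obtain ⟨Q'⟩ := Cofinite.nonempty_translatePartition T.cofinite_right
  change TranslatePartition Λ ν T.symm.dom.1 at Q'
  have hfree : ∀ r, Module.Projective (MonoidAlgebra Z Λ) (E.C r) := fun r =>
    haveI := E.free r
    inferInstance
  let F : ∀ r, ScalarExt μ C.toResolution r →ₗ[Crossed Γ Z μ] marked Γ Z μ (D.A r) := fun r =>
    extLift μ (φ.f r)
  have hF0 : ∀ k, D.η (F 0 k) = extAugmentation μ C.toResolution k := by
    intro k
    induction k using TensorProduct.induction_on with
    | zero => simp only [map_zero]
    | add k l hk hl => rw [map_add, map_add, map_add, hk, hl]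
    | tmul a x =>
      rw [extLift_tmul, map_smul, φ.augmented, single_smul, one_smul, extAugmentation_tmul,
        Algebra.smul_def, mul_comm, algebraMap_LInfty]
  have hF : ∀ r ≤ n, ∀ k, D.d r (F (r + 1) k) = F r (extBoundary μ C.toResolution r k) := by
    intro r hr k
    induction k using TensorProduct.induction_on with
    | zero => simp only [map_zero]
    | add k l hk hl => rw [map_add, map_add, map_add, map_add, hk, hl]
    | tmul a x =>
      rw [extLift_tmul, map_smul, φ.comm r hr, extBoundary_tmul, extLift_tmul]
  obtain ⟨G, hG0, hG⟩ := exists_chain_lift (groupRingToCrossed Λ Z ν)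
    (K := fun r => T.Coinduced Z (ScalarExt μ C.toResolution r)) E.d
    (fun r => Coinduced.map T (extBoundary μ C.toResolution r))
    (Coinduced.map T (extAugmentation μ C.toResolution))
    (T.coinducedAugmentation Z E.toResolution)
    (fun r x => (E.exact_succ r).apply_apply_eq_zero x)
    (fun x => Coinduced.exists_map_eq _ _ fun y => extAugmentation_surjective μ _ _)
    (fun x => by
      change Coinduced.ofFunction T (LInfty.const Z ν (E.ζ (E.d 0 x))) = 0
      rw [E.exact_zero.apply_apply_eq_zero, map_zero, map_zero])
    (fun k hk => Coinduced.exists_map_eq _ _ fun y => extAugmentation_exact μ _ _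
      (DFunLike.congr_fun (congrArg Subtype.val hk) y))
    (fun r k hk => Coinduced.exists_map_eq _ _ fun y => extBoundary_exact μ _ r _
      (DFunLike.congr_fun (congrArg Subtype.val hk) y))
  have hs : ∀ r, T.Compatible Z ((T.pushModule Q (D.A r)).comp (F r).toAddMonoidHom) := by
    intro r s k
    have h := T.compatible_pushModule Q (D.A r) s (F r k)
    rw [← map_smul, ← map_smul] at h
    exact h
  refine ⟨⟨fun r => (Coinduced.eval Q' _ (hs r)).comp (G r), fun x => ?_, fun r hr x => ?_⟩⟩
  · refine (Coinduced.eval_map Q' (hs 0) T.compatible_push (extAugmentation μ C.toResolution)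
      (T.pushHom Q D.η T.push) (fun k => ?_) (G 0 x)).trans ?_
    · exact (T.pushComplex_η_pushModule Q D (F 0 k)).trans (congrArg _ (hF0 k))
    · rw [hG0]
      exact Coinduced.eval_ofFunction Q' _
  · refine (Coinduced.eval_map Q' (hs (r + 1)) (hs r) (extBoundary μ C.toResolution r)
      (T.pushHom Q (D.d r) (T.pushModule Q (D.A r))) (fun k => ?_) (G (r + 1) x)).trans ?_
    · exact (T.pushComplex_d_pushModule Q D r (F (r + 1) k)).trans (congrArg _ (hF r hr k))
    · rw [hG]
      rfl

end Aug

/-! ### Comparison of the invariants -/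

section Compare

variable {Γ Λ : Type*} [Group Γ] [Group Λ] {X Y : Type*} [MeasurableSpace X]
  [MeasurableSpace Y] [StandardBorelSpace X] [StandardBorelSpace Y]
  [MulAction Γ X] [MulAction Λ Y] [MeasurableConstSMul Γ X] [MeasurableConstSMul Λ Y]
  {μ : Measure X} {ν : Measure Y} [IsFiniteMeasure μ] [IsFiniteMeasure ν]
  [SMulInvariantMeasure Γ X μ] [SMulInvariantMeasure Λ Y ν]
  {c : ℝ}

theorem ofReal_mul_iInf_le {σ τ : Type*} {S : Set σ} {S' : Set τ} {u : σ → ℝ} {v : τ → ℝ}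
    (hc : 0 < c) (h : ∀ D ∈ S, ∃ D' ∈ S', v D' ≤ c⁻¹ * u D) :
    ENNReal.ofReal c * ⨅ D' ∈ S', ENNReal.ofReal (v D') ≤ ⨅ D ∈ S, ENNReal.ofReal (u D) := by
  refine le_iInf₂ fun D hD => ?_
  obtain ⟨D', hD', hv⟩ := h D hD
  calc _ ≤ ENNReal.ofReal c * ENNReal.ofReal (v D') := by gcongr; exact iInf₂_le D' hD'
    _ = ENNReal.ofReal (c * v D') := (ENNReal.ofReal_mul hc.le).symm
    _ ≤ ENNReal.ofReal (u D) := ENNReal.ofReal_le_ofReal (by rwa [← le_inv_mul_iff₀ hc])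

theorem eq_of_mul_le {a b : ℝ≥0∞} (hc : 0 < c) (h : ENNReal.ofReal c * b ≤ a)
    (h' : ENNReal.ofReal c⁻¹ * a ≤ b) : a = ENNReal.ofReal c * b := by
  refine le_antisymm ?_ h
  calc a = ENNReal.ofReal c * (ENNReal.ofReal c⁻¹ * a) := by
        rw [← mul_assoc, ← ENNReal.ofReal_mul hc.le, mul_inv_cancel₀ hc.ne', ENNReal.ofReal_one,
          one_mul]
    _ ≤ _ := by gcongr

section General

variable {Z : Type*} [CommRing Z] [IsDomain Z] [IsPrincipalIdealRing Z]

theorem ofReal_mul_medim_le (T : BoundedOE Γ Λ μ ν c) (n : ℕ) (C : FreeResolution Z Γ)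
    (E : FreeResolution Z Λ) :
    ENNReal.ofReal c * medim ν n E ≤ medim μ n C := by
  obtain ⟨Q⟩ := Cofinite.nonempty_translatePartition T.cofinite_left
  exact ofReal_mul_iInf_le T.pos fun D hD =>
    ⟨T.pushComplex Q D, T.pushComplex_mem_Aug Q n C E hD, (T.dim_pushMarking Q (D.A n)).le⟩

theorem medim_eq (T : BoundedOE Γ Λ μ ν c) (n : ℕ) (C : FreeResolution Z Γ)
    (E : FreeResolution Z Λ) :
    medim μ n C = ENNReal.ofReal c * medim ν n E :=
  eq_of_mul_le T.pos (T.ofReal_mul_medim_le n C E) (T.symm.ofReal_mul_medim_le n E C)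

end General

theorem ofReal_mul_mevol_le (T : BoundedOE Γ Λ μ ν c) (n : ℕ) (C : FreeResolution ℤ Γ)
    (E : FreeResolution ℤ Λ) :
    ENNReal.ofReal c * mevol ν n E ≤ mevol μ n C := by
  obtain ⟨Q⟩ := Cofinite.nonempty_translatePartition T.cofinite_left
  exact ofReal_mul_iInf_le T.pos fun D hD =>
    ⟨T.pushComplex Q D, T.pushComplex_mem_Aug Q n C E hD,
      T.lognorm_le Q (D.d n) _ fun z => T.pushComplex_d_pushModule Q D n z⟩

theorem mevol_eq (T : BoundedOE Γ Λ μ ν c) (n : ℕ) (C : FreeResolution ℤ Γ)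
    (E : FreeResolution ℤ Λ) :
    mevol μ n C = ENNReal.ofReal c * mevol ν n E :=
  eq_of_mul_le T.pos (T.ofReal_mul_mevol_le n C E) (T.symm.ofReal_mul_mevol_le n E C)

end Compare

end BoundedOE

theorem Cofinite.measure_ne_zero {Γ X : Type*} [Group Γ] [MeasurableSpace X] [MulAction Γ X]
    [MeasurableConstSMul Γ X] {μ : Measure X} [NeZero μ] [SMulInvariantMeasure Γ X μ] {A : Set X}
    (h : Cofinite Γ μ A) : μ A ≠ 0 := by
  intro h0
  obtain ⟨-, F, hF⟩ := h
  have h1 : ∀ᵐ x ∂μ, x ∉ ⋃ γ ∈ F, γ • A := by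
    rw [ae_iff]
    simp only [not_not]
    refine (measure_biUnion_null_iff F.countable_toSet).2 fun γ _ => ?_
    rw [measure_smul, h0]
  have h2 : ∀ᵐ _ ∂μ, False := by
    filter_upwards [hF, h1] with x ⟨γ, hγ, hx⟩ hx'
    exact hx' (Set.mem_biUnion hγ hx)
  exact NeZero.ne μ (Measure.measure_univ_eq_zero.1 (by simpa [ae_iff] using h2))

/-- Weak bounded orbit equivalences can be put into the symmetric form with total maps. -/
theorem WeaklyBoundedOE.nonempty_boundedOE {Γ Λ : Type*} [Group Γ] [Group Λ] {X Y : Type*}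
    [MeasurableSpace X] [MeasurableSpace Y] [MulAction Γ X] [MulAction Λ Y]
    [MeasurableConstSMul Γ X] [MeasurableConstSMul Λ Y] {μ : Measure X} {ν : Measure Y}
    [IsProbabilityMeasure μ] [IsProbabilityMeasure ν] [SMulInvariantMeasure Γ X μ]
    [SMulInvariantMeasure Λ Y ν] (hα : EssentiallyFree Γ μ) (hβ : EssentiallyFree Λ ν) {c : ℝ}
    (hc : 0 < c) (h : WeaklyBoundedOE Γ Λ μ ν c) : Nonempty (BoundedOE Γ Λ μ ν c) := by
  obtain ⟨A, B, φ, hA, hB, hmap, hcdef, hp, hq⟩ := h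
  have hμA := hA.measure_ne_zero
  have hνB := hB.measure_ne_zero
  obtain ⟨x₀, -⟩ := nonempty_of_measure_ne_zero hμA
  obtain ⟨y₀, -⟩ := nonempty_of_measure_ne_zero hνB
  obtain ⟨p, hpm, hpφ⟩ := (MeasurableEmbedding.subtype_coe hA.1).exists_measurable_extend
    (measurable_subtype_coe.comp φ.measurable) fun _ => ⟨y₀⟩
  obtain ⟨q, hqm, hqφ⟩ := (MeasurableEmbedding.subtype_coe hB.1).exists_measurable_extend
    (measurable_subtype_coe.comp φ.symm.measurable) fun _ => ⟨x₀⟩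
  have hpA : ∀ x (hx : x ∈ A), p x = φ ⟨x, hx⟩ := fun x hx => congrFun hpφ ⟨x, hx⟩
  have hqB : ∀ y (hy : y ∈ B), q y = φ.symm ⟨y, hy⟩ := fun y hy => congrFun hqφ ⟨y, hy⟩
  have hqp : ∀ x ∈ A, q (p x) = x := fun x hx => by
    rw [hqB _ (hpA x hx ▸ (φ ⟨x, hx⟩).2)]
    simp only [hpA x hx, Subtype.coe_eta, MeasurableEquiv.symm_apply_apply]
  have hpq : ∀ y ∈ B, p (q y) = y := fun y hy => by
    rw [hpA _ (hqB y hy ▸ (φ.symm ⟨y, hy⟩).2)]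
    simp only [hqB y hy, Subtype.coe_eta, MeasurableEquiv.apply_symm_apply]
  have hcE : ENNReal.ofReal c = μ A * (ν B)⁻¹ := by
    rw [hcdef, ENNReal.ofReal_div_of_pos, measureReal_def, measureReal_def,
      ENNReal.ofReal_toReal (measure_ne_top μ A), ENNReal.ofReal_toReal (measure_ne_top ν B),
      ENNReal.div_eq_inv_mul, mul_comm]
    exact ENNReal.toReal_pos hνB (measure_ne_top ν B)
  have hmap' : (μ.comap ((↑) : A → X)).map φ =
      ENNReal.ofReal c • ν.comap ((↑) : B → Y) := by
    have h1 := congrArg (fun m => μ A • m) hmap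
    simp only [smul_smul] at h1
    rwa [ENNReal.mul_inv_cancel hμA (measure_ne_top μ A), one_smul, ← hcE] at h1
  have hmp : (μ.restrict A).map p = ENNReal.ofReal c • ν.restrict B := by
    rw [← map_comap_subtype_coe hA.1, Measure.map_map hpm measurable_subtype_coe, hpφ,
      ← Measure.map_map measurable_subtype_coe φ.measurable, hmap', Measure.map_smul,
      map_comap_subtype_coe hB.1]
  have hmq : (ν.restrict B).map q = ENNReal.ofReal c⁻¹ • μ.restrict A := by
    have h1 : ((μ.restrict A).map p).map q = μ.restrict A := by
      rw [Measure.map_map hqm hpm]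
      conv_rhs => rw [← Measure.map_id (μ := μ.restrict A)]
      refine Measure.map_congr ?_
      filter_upwards [ae_restrict_mem hA.1] with x hx
      exact hqp x hx
    rw [hmp, Measure.map_smul] at h1
    rw [← h1, smul_smul, ← ENNReal.ofReal_mul (inv_pos.2 hc).le, inv_mul_cancel₀ hc.ne',
      ENNReal.ofReal_one, one_smul]
  refine ⟨⟨A, B, p, q, hα, hβ, hA, hB, hpm, hqm, ?_, ?_, hqp, hpq, hc, hmp, hmq, ?_, ?_⟩⟩
  · intro x hx
    rw [hpA x hx]
    exact (φ ⟨x, hx⟩).2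
  · intro y hy
    rw [hqB y hy]
    exact (φ.symm ⟨y, hy⟩).2
  · intro γ
    obtain ⟨F, hF⟩ := hp γ
    refine ⟨F, ?_⟩
    filter_upwards [hF] with x hx h1 h2
    rw [hpA _ h1, hpA _ h2]
    exact hx h1 h2
  · intro l
    obtain ⟨E, hE⟩ := hq l
    refine ⟨E, ?_⟩
    filter_upwards [hE] with y hy h1 h2
    rw [hqB _ h1, hqB _ h2]
    exact hy h1 h2

end MeasuredEmbedding

end

theorem theorem1p8
    {Γ : Type u₁} [Group Γ] [Countable Γ] {Λ : Type u₂} [Group Λ] [Countable Λ]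
    {X : Type v₁} [MeasurableSpace X] [StandardBorelSpace X]
    {Y : Type v₂} [MeasurableSpace Y] [StandardBorelSpace Y]
    (μ : Measure X) [IsProbabilityMeasure μ] (ν : Measure Y) [IsProbabilityMeasure ν]
    [MulAction Γ X] [MeasurableConstSMul Γ X] [SMulInvariantMeasure Γ X μ]
    [MulAction Λ Y] [MeasurableConstSMul Λ Y] [SMulInvariantMeasure Λ Y ν]
    (hα : MeasuredEmbedding.EssentiallyFree Γ μ) (hβ : MeasuredEmbedding.EssentiallyFree Λ ν)
    (n : ℕ) (hΓ : MeasuredEmbedding.TypeFP (n + 1) Γ) (hΛ : MeasuredEmbedding.TypeFP (n + 1) Λ)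
    (c : ℝ) (hc : 0 < c) (h : MeasuredEmbedding.WeaklyBoundedOE Γ Λ μ ν c) :
    (∀ (C : MeasuredEmbedding.FreeResolution.{0, u₁, w₁} ℤ Γ)
        (E : MeasuredEmbedding.FreeResolution.{0, u₂, w₂} ℤ Λ),
      MeasuredEmbedding.medim μ n C = ENNReal.ofReal c * MeasuredEmbedding.medim ν n E ∧
      MeasuredEmbedding.mevol μ n C = ENNReal.ofReal c * MeasuredEmbedding.mevol ν n E) ∧
    (∀ (F : Type w) [Field F] [Finite F]
        (C : MeasuredEmbedding.FreeResolution.{w, u₁, w₃} F Γ)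
        (E : MeasuredEmbedding.FreeResolution.{w, u₂, w₄} F Λ),
      MeasuredEmbedding.medim μ n C = ENNReal.ofReal c * MeasuredEmbedding.medim ν n E) := by
  obtain ⟨T⟩ := h.nonempty_boundedOE hα hβ hc
  exact ⟨fun C E => ⟨T.medim_eq n C E, T.mevol_eq n C E⟩, fun F _ _ C E => T.medim_eq n C E⟩
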